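/- Let $k\in\mathbb C$ and $c=k+1$. Assume first that $k\neq-2$, and let $B=\mathbb C[x,y,t;q^{\pm1}]$ with $x=(x_n)_{n\ge1}$, $y=(y_n)_{n\ge1}$, $t=(t_n)_{n\ge1}$. Let the modes of the fields $\alpha(z),\gamma(z),\delta(z)$, where $\phi(z)=\sum_{n\in\mathbb Z}\phi_{(n)}z^{-n-1}$, act on $B$ by (for $n>0$) $$\alpha_{(n)}=\partial_{x_n}+c\,\partial_{y_n}+\partial_{t_n},\quad \alpha_{(-n)}=nx_n,\quad \alpha_{(0)}=q\partial_q,$$ $$\gamma_{(n)}=c\,\partial_{x_n}+\partial_{y_n}-\partial_{t_n},\quad \gamma_{(-n)}=ny_n,\quad \gamma_{(0)}=-q\partial_q,$$ $$\delta_{(n)}=\partial_{x_n}-\partial_{y_n},\quad \delta_{(-n)}=nt_n,\quad \delta_{(0)}=0,$$ and put $e^{\pm\delta}(z)=q^{\pm1}\exp\Bigl(\pm\sum_{n>0}\delta_{(-n)}\frac{z^n}{n}\Bigr)\exp\Bigl(\mp\sum_{n>0}\delta_{(n)}\frac{z^{-n}}{n}\Bigr)$. Let $\widehat{\mathfrak{sl}}_2$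 act on $B$ with level $k$ through the modes of $$e(z)={:}\alpha(z)e^{\delta}(z){:},\qquad f(z)={:}\gamma(z)e^{-\delta}(z){:},\qquad h(z)=k\delta(z)+\alpha(z)-\gamma(z),$$ where ${:}a(z)b(z){:}=\Bigl(\sum_{j<0}a_{(j)}z^{-j-1}\Bigr)b(z)+b(z)\Bigl(\sum_{j\ge0}a_{(j)}z^{-j-1}\Bigr)$, and let it act diagonally on $B\otimes B$. Let $$L(z)=\tfrac{c-1}{4}{:}\delta(z)\delta(z){:}+\tfrac12{:}\delta(z)(\alpha-\gamma)(z){:}+\tfrac1{4(c+1)}{:}(\alpha+\gamma)(z)(\alpha+\gamma)(z){:}$$ and $$\Omega(z)=e(z)\otimes f(z)+f(z)\otimes e(z)+\tfrac12h(z)\otimes h(z)-k\otimes L(z)-L(z)\otimes k,\qquad \Omega_{(0)}=\operatorname{Res}_z\Omega(z).$$ Then every $\tau\in B$ such that $\tau\otimes\tau$ lies in the $\widehat{\mathfrak{sl}}_2$-submodule of $B\otimes B$ generated by $1\otimes1$ satisfies the untwisted Wakimoto hierarchy $$\Omega_{(0)}(\tau\otimes\tau)=0.$$ At the critical level $k=-2$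 (so $c=-1$) the same holds when one sets $\gamma=-\alpha$ and removes the last term of $L(z)$; that is, $y_n=-x_n$ and $B=\mathbb C[x,t;q^{\pm1}]$, with $\alpha_{(n)}=-\gamma_{(n)}=\partial_{x_n}+\partial_{t_n}$, $\delta_{(n)}=\partial_{x_n}$, $\alpha_{(-n)}=-\gamma_{(-n)}=nx_n$, $\delta_{(-n)}=nt_n$ for $n>0$, $\alpha_{(0)}=-\gamma_{(0)}=q\partial_q$ and $\delta_{(0)}=0$. -/

import Mathlib

open scoped TensorProduct

namespace Wakimoto

noncomputable section

/-! ### Locally finite sums, fields, normally ordered products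

A field `a(z) = ∑ₙ a₍ₙ₎ z⁻ⁿ⁻¹` on a complex vector space `M` is given by its family of modes
`a : ℤ → Module.End ℂ M`. -/

open Classical in
/-- The sum of a locally finite family of operators: `v ↦ ∑ᵢ F i v`, where for every `v` only
finitely many terms are non-zero. (A family that is not locally finite has no sum; it gets
the value `0`.) -/
def lfSum {ι M : Type*} [AddCommGroup M] [Module ℂ M] (F : ι → Module.End ℂ M) :
    Module.End ℂ M :=
  if hF : ∀ v, (Function.support fun i => F i v).Finite then
    { toFun := fun v => ∑ᶠ i, F i v
      map_add' := fun v w => by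
        simp only [map_add]
        exact finsum_add_distrib (hF v) (hF w)
      map_smul' := fun c v => by
        simp only [map_smul, RingHom.id_apply]
        exact (smul_finsum' c (hF v)).symm }
  else 0

/-- The modes of the normally ordered product
`:a(z)b(z): = a(z)₊ b(z) + b(z) a(z)₋`, where `a(z)₋ = ∑_{j ≥ 0} a₍ⱼ₎ z⁻ʲ⁻¹` and
`a(z)₊ = ∑_{j < 0} a₍ⱼ₎ z⁻ʲ⁻¹`. -/
def normalOrder {M : Type*} [AddCommGroup M] [Module ℂ M] (a b : ℤ → Module.End ℂ M) (n : ℤ) :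
    Module.End ℂ M :=
  lfSum fun j : ℤ => if j < 0 then a j * b (n - j - 1) else b (n - j - 1) * a j

/-- The modes of the field `a(z) ⊗ b(z)` on `M ⊗ M`. -/
def tensorField {M : Type*} [AddCommGroup M] [Module ℂ M] (a b : ℤ → Module.End ℂ M) (n : ℤ) :
    Module.End ℂ (M ⊗[ℂ] M) :=
  lfSum fun j : ℤ => TensorProduct.map (a j) (b (n - j - 1))

/-- The coefficient of `z ^ m` in `exp (∑_{n ≥ 1} uₙ zⁿ)`, for operators `uₙ`. The exponential series
is cut off at `j = m` because the `j`-th power of the argument is divisible by `z ^ j`. -/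
def expCoeff {M : Type*} [AddCommGroup M] [Module ℂ M] (u : ℕ → Module.End ℂ M) (m : ℕ) :
    Module.End ℂ M :=
  ∑ j ∈ Finset.range (m + 1), ((j.factorial : ℂ)⁻¹) •
    PowerSeries.coeff m ((PowerSeries.mk fun n => if n = 0 then 0 else u n) ^ j)

/-! ### The vertex operators built from the Heisenberg fields -/

/-- The modes of the three Heisenberg fields `α(z)`, `γ(z)`, `δ(z)` on a Fock space `M`, the
operators `q ^ m` of multiplication by `e^{mδ}`, and the vacuum vector. It is used below for the two
explicit Fock spaces only. -/
structure FockModes (M : Type*) [AddCommGroup M] [Module ℂ M] where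
  α : ℤ → Module.End ℂ M
  γ : ℤ → Module.End ℂ M
  δ : ℤ → Module.End ℂ M
  q : ℤ → Module.End ℂ M
  vac : M

namespace FockModes

variable {M : Type*} [AddCommGroup M] [Module ℂ M] (D : FockModes M)

/-- The modes of
`e^{εδ}(z) = q^ε exp(ε ∑_{n>0} δ₍₋ₙ₎ zⁿ/n) exp(-ε ∑_{n>0} δ₍ₙ₎ z⁻ⁿ/n)`, for `ε = ±1`
(the factor `z^{εδ₍₀₎}` is absent because `δ₍₀₎ = 0` on the Fock spaces below).
The term with `z ^ l` from the first and `z ^ (-m)` from the second exponential contributes to the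
mode `n` with `l - m = -n - 1`. -/
def expField (ε : ℤ) (n : ℤ) : Module.End ℂ M :=
  lfSum fun p : ℕ × ℕ =>
    if (p.1 : ℤ) - (p.2 : ℤ) = -n - 1 then
      D.q ε * expCoeff (fun i => ((ε : ℂ) / (i : ℂ)) • D.δ (-(i : ℤ))) p.1
        * expCoeff (fun i => (-((ε : ℂ) / (i : ℂ))) • D.δ (i : ℤ)) p.2
    else 0

/-- `e(z) = :α(z) e^δ(z):` -/
def e : ℤ → Module.End ℂ M := normalOrder D.α (D.expField 1)

/-- `f(z) = :γ(z) e^{-δ}(z):` -/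
def f : ℤ → Module.End ℂ M := normalOrder D.γ (D.expField (-1))

/-- `h(z) = k δ(z) + α(z) - γ(z)` -/
def h (k : ℂ) (n : ℤ) : Module.End ℂ M := k • D.δ n + D.α n - D.γ n

/-- The mode `a₍ₘ₎` (the action of `a ⊗ tᵐ`) of an arbitrary element
`a = a₀₁ e + a₁₀ f + a₀₀ h` of `𝔰𝔩₂`. -/
def current (k : ℂ) (a : LieAlgebra.SpecialLinear.sl (Fin 2) ℂ) (m : ℤ) : Module.End ℂ M :=
  a.1 0 1 • D.e m + a.1 1 0 • D.f m + a.1 0 0 • D.h k m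

/-- The modes `ω₍ₙ₎ = Lₙ₋₁` of the Virasoro field of the lattice vertex algebra, with `c = k + 1`:
`L = (c-1)/4 :δδ: + 1/2 :δ(α-γ): + 1/(4(c+1)) :(α+γ)(α+γ):`.
At the critical level `c = -1`, where `α + γ = 0`, the last term is to be removed, and it does vanish
here. -/
def virasoro (k : ℂ) (n : ℤ) : Module.End ℂ M :=
  (k / 4) • normalOrder D.δ D.δ n
    + (1 / 2 : ℂ) • normalOrder D.δ (D.α - D.γ) n
    + (1 / (4 * (k + 2))) • normalOrder (D.α + D.γ) (D.α + D.γ) n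

/-- The modes on `M ⊗ M` of the Casimir field
`Ω(z) = e(z) ⊗ f(z) + f(z) ⊗ e(z) + 1/2 h(z) ⊗ h(z) - k ⊗ L(z) - L(z) ⊗ k`. -/
def casimir (k : ℂ) (n : ℤ) : Module.End ℂ (M ⊗[ℂ] M) :=
  tensorField D.e D.f n + tensorField D.f D.e n
    + (1 / 2 : ℂ) • tensorField (D.h k) (D.h k) n
    - TensorProduct.map (k • LinearMap.id) (D.virasoro k n)
    - TensorProduct.map (D.virasoro k n) (k • LinearMap.id)

/-- The diagonal action of `a ⊗ tᵐ` on `M ⊗ M`. -/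
def diagCurrent (k : ℂ) (a : LieAlgebra.SpecialLinear.sl (Fin 2) ℂ) (m : ℤ) :
    Module.End ℂ (M ⊗[ℂ] M) :=
  TensorProduct.map (D.current k a m) LinearMap.id
    + TensorProduct.map LinearMap.id (D.current k a m)

/-- The submodule over the affine Lie algebra of `𝔰𝔩₂` of `M ⊗ M` generated by `vac ⊗ vac`: the
smallest subspace that contains this vector and is stable under the diagonal action of all `a ⊗ tᵐ`.
(The central element acts by a scalar.) -/
def vacSubmodule (k : ℂ) : Submodule ℂ (M ⊗[ℂ] M) :=
  sInf {W | D.vac ⊗ₜ[ℂ] D.vac ∈ W ∧ ∀ a m, ∀ w ∈ W, D.diagCurrent k a m w ∈ W}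

end FockModes

/-! ### The bosonic Fock spaces -/

/-- `ℂ[uₙ (u ∈ s, n ≥ 1); q, q⁻¹]`, as Laurent polynomials in `q` over a polynomial ring. -/
abbrev Fock (s : Type) : Type := LaurentPolynomial (MvPolynomial (s × ℕ+) ℂ)

variable {s : Type}

/-- Multiplication by the variable `uₙ`. -/
def mulVar (u : s) (n : ℕ+) : Module.End ℂ (Fock s) :=
  LinearMap.mulLeft ℂ (LaurentPolynomial.C (MvPolynomial.X (u, n)))

/-- The partial derivative `∂/∂uₙ`, acting on each coefficient of a Laurent polynomial in `q`. -/
def dVar (u : s) (n : ℕ+) : Module.End ℂ (Fock s) :=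
  (AddMonoidAlgebra.coeffLinearEquiv ℂ).symm.toLinearMap ∘ₗ
    Finsupp.mapRange.linearMap (MvPolynomial.pderiv (R := ℂ) (u, n)).toLinearMap ∘ₗ
    (AddMonoidAlgebra.coeffLinearEquiv ℂ).toLinearMap

/-- The operator `q ∂/∂q`, which multiplies the coefficient of `q ^ m` by `m`. -/
def qdq : Module.End ℂ (Fock s) :=
  (AddMonoidAlgebra.coeffLinearEquiv ℂ).symm.toLinearMap ∘ₗ
    (Finsupp.lsum ℂ fun m : ℤ => (m : ℂ) • Finsupp.lsingle m) ∘ₗ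
    (AddMonoidAlgebra.coeffLinearEquiv ℂ).toLinearMap

/-- Multiplication by `q ^ m`. -/
def mulQ (m : ℤ) : Module.End ℂ (Fock s) := LinearMap.mulLeft ℂ (LaurentPolynomial.T m)

/-- The modes of a Heisenberg field: `ann n` is the mode `n` and `n • mulVar u n` (that is, `n uₙ`)
the mode `-n`, for `n > 0`, and `zero` is the mode `0`. -/
def heisenberg (ann : ℕ+ → Module.End ℂ (Fock s)) (zero : Module.End ℂ (Fock s)) (u : s) :
    ℤ → Module.End ℂ (Fock s)
  | Int.ofNat 0 => zero
  | Int.ofNat (n + 1) => ann n.succPNat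
  | Int.negSucc n => ((n + 1 : ℕ) : ℂ) • mulVar u n.succPNat

/-- The three sequences of variables `x`, `y`, `t`. -/
inductive XYT
  | x
  | y
  | t

/-- The two sequences of variables `x`, `t` left at the critical level. -/
inductive XT
  | x
  | t

/-- The action of the Heisenberg fields on `B = ℂ[x, y, t; q, q⁻¹]`. -/
def fockModes (c : ℂ) : FockModes (Fock XYT) where
  α := heisenberg (fun n => dVar XYT.x n + c • dVar XYT.y n + dVar XYT.t n) qdq XYT.x
  γ := heisenberg (fun n => c • dVar XYT.x n + dVar XYT.y n - dVar XYT.t n) (-qdq) XYT.y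
  δ := heisenberg (fun n => dVar XYT.x n - dVar XYT.y n) 0 XYT.t
  q := mulQ
  vac := 1

/-- The action of the Heisenberg fields on the Fock space at the critical level `k = -2` (`c = -1`),
where `γ = -α`: the variables satisfy `yₙ = -xₙ`, so that `B = ℂ[x, t; q, q⁻¹]`. -/
def critFockModes : FockModes (Fock XT) where
  α := heisenberg (fun n => dVar XT.x n + dVar XT.t n) qdq XT.x
  γ := -heisenberg (fun n => dVar XT.x n + dVar XT.t n) qdq XT.x
  δ := heisenberg (fun n => dVar XT.x n) 0 XT.t
  q := mulQ
  vac := 1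

end

end Wakimoto

/-!
The operator `Ω₍₀₎` annihilates `1 ⊗ 1` and commutes with the diagonal action of the affine Lie algebra,
so its kernel contains the submodule generated by `1 ⊗ 1`. Two facts about the Wakimoto fields are
behind this: the modes of `e`, `f`, `h` satisfy the relations of affine `𝔰𝔩₂` at level `k`
(`bracket_e_e`, `bracket_e_f`, `bracket_h_e` and their companions), and the operator `L₋₁ = ω₍₀₎` acts on
them as the derivative, `[a₍ₙ₎, L₋₁] = n a₍ₙ₋₁₎` (`bracket_e_virasoro` and its companions). In the
commutator of `Ω₍₀₎` with `a₍ₘ₎ ⊗ 1 + 1 ⊗ a₍ₘ₎` the Lie brackets cancel by invariance of the Casimir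
tensor. What remains is the central term `m k (a₍ₘ₋₁₎ ⊗ 1 + 1 ⊗ a₍ₘ₋₁₎)`, and the brackets with
`k ⊗ L₋₁ + L₋₁ ⊗ k` cancel it.

All infinite sums of operators are locally finite. The relations between normally ordered products come
from four rules: an inner derivation acts on the two factors by the Leibniz rule
(`normalOrder_bracket`), as does `∂` (`derivField_normalOrder`); multiplying the left factor by `zᵐ`
moves finitely many terms across the ordering (`normalOrder_shift_left`); and if
`[a₍ᵢ₎, C₍ⱼ₎] = κ C₍ᵢ₊ⱼ₎`, then `::aB:C: = :a(BC): + κ :∂B C:` (`normalOrder_assoc`).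
About the vertex operators `e^{±δ}` one needs only their commutators with the Heisenberg fields
(`bracket_expField`), the equation `∂e^{εδ} = ε :δ e^{εδ}:` (`derivField_expField`), and
`e^{δ} e^{-δ} = 1` (`normalOrder_expField_neg`).

Everything is proved for a space with Heisenberg fields of the relevant Gram matrix that is generated
from its vacuum (`IsFock`). At the critical level this matrix is degenerate; there `α + γ = 0`, which
replaces the division by `k + 2` in the computation of `[α₍ₙ₎, L₋₁]` and `[γ₍ₙ₎, L₋₁]`.
-/

namespace Wakimoto

noncomputable section

open Function

/-! ### Calculus of locally finite sums -/

section Calculus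

variable {ι κ M : Type*} [AddCommGroup M] [Module ℂ M]

/-- A family of operators is locally finite if only finitely many of its members are non-zero on any
given vector. -/
def LocallyFinite (F : ι → Module.End ℂ M) : Prop :=
  ∀ v, (support fun i => F i v).Finite

theorem lfSum_apply {F : ι → Module.End ℂ M} (hF : LocallyFinite F) (v : M) :
    lfSum F v = ∑ᶠ i, F i v := by
  have h : ∀ v, (support fun i => F i v).Finite := hF
  simp [lfSum, h]

namespace LocallyFinite

variable {F G : ι → Module.End ℂ M}

theorem add (hF : LocallyFinite F) (hG : LocallyFinite G) : LocallyFinite (fun i => F i + G i) :=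
  fun v => ((hF v).union (hG v)).subset (by
    intro i hi
    by_contra hc
    simp only [Set.mem_union, mem_support, not_or, not_not] at hc
    exact hi (by simp [hc.1, hc.2]))

theorem neg (hF : LocallyFinite F) : LocallyFinite (fun i => -F i) :=
  fun v => (hF v).subset fun i hi hc => hi (by simp [hc])

theorem sub (hF : LocallyFinite F) (hG : LocallyFinite G) : LocallyFinite (fun i => F i - G i) := by
  simpa only [sub_eq_add_neg] using hF.add hG.neg

theorem smul (c : ℂ) (hF : LocallyFinite F) : LocallyFinite (fun i => c • F i) :=
  fun v => (hF v).subset fun i hi hc => hi (by simp [hc])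

theorem mul_left (X : Module.End ℂ M) (hF : LocallyFinite F) : LocallyFinite (fun i => X * F i) :=
  fun v => (hF v).subset fun i hi hc => hi (by simp [hc])

theorem mul_right (X : Module.End ℂ M) (hF : LocallyFinite F) : LocallyFinite (fun i => F i * X) :=
  fun v => hF (X v)

theorem comp_injective {e : κ → ι} (he : Injective e) (hF : LocallyFinite F) :
    LocallyFinite (fun i => F (e i)) :=
  fun v => (hF v).preimage he.injOn

/-- A family on a product is locally finite if, on each vector, only finitely many first indices
matter and the family is locally finite for each first index. -/
theorem of_fibers {F : ι × κ → Module.End ℂ M} (h1 : ∀ v, {i | ∃ j, F (i, j) v ≠ 0}.Finite)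
    (h2 : ∀ i, LocallyFinite fun j => F (i, j)) : LocallyFinite F := by
  intro v
  refine Set.Finite.of_finite_fibers Prod.fst ((h1 v).subset ?_) ?_
  · rintro _ ⟨⟨i, j⟩, hij, rfl⟩
    exact ⟨j, hij⟩
  · intro i _
    refine ((h2 i v).image fun j => (i, j)).subset ?_
    rintro ⟨i', j⟩ ⟨hij, rfl⟩
    exact ⟨j, hij, rfl⟩

end LocallyFinite

variable {F G : ι → Module.End ℂ M}

theorem lfSum_add (hF : LocallyFinite F) (hG : LocallyFinite G) :
    lfSum (fun i => F i + G i) = lfSum F + lfSum G := by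
  ext v
  rw [LinearMap.add_apply, lfSum_apply (hF.add hG), lfSum_apply hF, lfSum_apply hG]
  exact finsum_add_distrib (hF v) (hG v)

theorem mul_lfSum (X : Module.End ℂ M) (hF : LocallyFinite F) :
    X * lfSum F = lfSum fun i => X * F i := by
  ext v
  rw [lfSum_apply (hF.mul_left X), Module.End.mul_apply, lfSum_apply hF]
  exact map_finsum X (hF v)

theorem lfSum_mul (X : Module.End ℂ M) (hF : LocallyFinite F) :
    lfSum F * X = lfSum fun i => F i * X := by
  ext v
  rw [lfSum_apply (hF.mul_right X), Module.End.mul_apply, lfSum_apply hF]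
  rfl

theorem smul_lfSum (c : ℂ) (hF : LocallyFinite F) :
    c • lfSum F = lfSum fun i => c • F i := by
  ext v
  rw [lfSum_apply (hF.smul c), LinearMap.smul_apply, lfSum_apply hF]
  exact smul_finsum' c (hF v)

theorem lfSum_sub (hF : LocallyFinite F) (hG : LocallyFinite G) :
    lfSum (fun i => F i - G i) = lfSum F - lfSum G := by
  rw [eq_sub_iff_add_eq, ← lfSum_add (hF.sub hG) hG]
  simp

theorem bracket_lfSum (X : Module.End ℂ M) (hF : LocallyFinite F) :
    ⁅X, lfSum F⁆ = lfSum fun i => ⁅X, F i⁆ := by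
  simp only [Ring.lie_def]
  rw [mul_lfSum X hF, lfSum_mul X hF, lfSum_sub (hF.mul_left X) (hF.mul_right X)]

theorem lfSum_comp_equiv (e : κ ≃ ι) (hF : LocallyFinite F) :
    lfSum (fun i => F (e i)) = lfSum F := by
  ext v
  rw [lfSum_apply (hF.comp_injective e.injective), lfSum_apply hF]
  exact finsum_comp_equiv e (f := fun i => F i v)

theorem lfSum_eq_single (i₀ : ι) (h : ∀ i, i ≠ i₀ → F i = 0) : lfSum F = F i₀ := by
  have hF : LocallyFinite F := fun v => (Set.finite_singleton i₀).subset fun i hi => by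
    by_contra hc
    exact hi (by simp [h i hc])
  ext v
  rw [lfSum_apply hF]
  exact finsum_eq_single _ _ fun i hi => by simp [h i hi]

/-- Fubini for locally finite double sums. -/
theorem lfSum_curry {F : ι × κ → Module.End ℂ M} (hF : LocallyFinite F) :
    lfSum F = lfSum fun i => lfSum fun j => F (i, j) := by
  have h1 : ∀ i, LocallyFinite fun j => F (i, j) := fun i =>
    hF.comp_injective (Prod.mk_right_injective i)
  have h2 : LocallyFinite fun i => lfSum fun j => F (i, j) := by
    intro v
    refine ((hF v).image Prod.fst).subset fun i hi => ?_
    by_contra hc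
    apply hi
    show (lfSum fun j => F (i, j)) v = 0
    rw [lfSum_apply (h1 i)]
    refine (finsum_congr fun j => ?_).trans finsum_zero
    by_contra hj
    exact hc ⟨(i, j), hj, rfl⟩
  ext v
  rw [lfSum_apply hF, lfSum_apply h2, finsum_curry _ (hF v)]
  exact finsum_congr fun i => (lfSum_apply (h1 i) v).symm

theorem bracket_mul (X A B : Module.End ℂ M) : ⁅X, A * B⁆ = ⁅X, A⁆ * B + A * ⁅X, B⁆ := by
  simp only [Ring.lie_def]
  noncomm_ring

theorem bracket_smul (X A : Module.End ℂ M) (r : ℂ) : ⁅X, r • A⁆ = r • ⁅X, A⁆ := by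
  simp only [Ring.lie_def, mul_smul_comm, smul_mul_assoc, smul_sub]

theorem bracket_add (X A B : Module.End ℂ M) : ⁅X, A + B⁆ = ⁅X, A⁆ + ⁅X, B⁆ := by
  simp only [Ring.lie_def]
  noncomm_ring

theorem bracket_sub (X A B : Module.End ℂ M) : ⁅X, A - B⁆ = ⁅X, A⁆ - ⁅X, B⁆ := by
  simp only [Ring.lie_def]
  noncomm_ring

theorem bracket_zero (X : Module.End ℂ M) : ⁅X, (0 : Module.End ℂ M)⁆ = 0 := by
  simp only [Ring.lie_def, mul_zero, zero_mul, sub_self]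

theorem bracket_skew (X A : Module.End ℂ M) : -⁅X, A⁆ = ⁅A, X⁆ := by
  simp only [Ring.lie_def, neg_sub]

theorem smul_bracket (X A : Module.End ℂ M) (r : ℂ) : ⁅r • X, A⁆ = r • ⁅X, A⁆ := by
  simp only [Ring.lie_def, mul_smul_comm, smul_mul_assoc, smul_sub]

theorem add_bracket (X Y A : Module.End ℂ M) : ⁅X + Y, A⁆ = ⁅X, A⁆ + ⁅Y, A⁆ := by
  simp only [Ring.lie_def]
  noncomm_ring

theorem sub_bracket (X Y A : Module.End ℂ M) : ⁅X - Y, A⁆ = ⁅X, A⁆ - ⁅Y, A⁆ := by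
  simp only [Ring.lie_def]
  noncomm_ring

theorem bracket_swap (X A : Module.End ℂ M) : ⁅X, A⁆ = (-1 : ℂ) • ⁅A, X⁆ := by
  rw [neg_one_smul, bracket_skew]

/-- Together with the next two lemmas, this replaces negation and subtraction by scalar multiples. On
the concrete space `Fock s` the additive structures which `Module.End` inherits along different paths
agree only after unfolding, so such rewriting is done over an abstract space. -/
theorem neg_eq_neg_one_smul (X : Module.End ℂ M) : -X = (-1 : ℂ) • X := (neg_one_smul ℂ X).symm

theorem sub_eq_add_neg_one_smul (X Y : Module.End ℂ M) : X - Y = X + (-1 : ℂ) • Y := by module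

theorem add_neg_one_smul (X : Module.End ℂ M) : X + (-1 : ℂ) • X = 0 := by module

/-! ### Fields and their normally ordered products -/

/-- A family of modes `a₍ₙ₎` is a field if each vector is annihilated by `a₍ₙ₎` for `n` large. -/
def IsField (a : ℤ → Module.End ℂ M) : Prop := ∀ v, ∃ N : ℤ, ∀ n ≥ N, a n v = 0

/-- The modes of `zᵐ a(z)`. -/
def shiftField (a : ℤ → Module.End ℂ M) (m : ℤ) : ℤ → Module.End ℂ M := fun n => a (n + m)

/-- The modes of the derivative `∂a(z)`. -/
def derivField (a : ℤ → Module.End ℂ M) : ℤ → Module.End ℂ M := fun n => (-(n : ℂ)) • a (n - 1)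

/-- The modes of the scalar field `c z^(-m-1)`. -/
def monoField (c : ℂ) (m : ℤ) : ℤ → Module.End ℂ M := fun n => if n = m then c • 1 else 0

/-- The term with index `j` in the mode `n` of the normally ordered product. -/
def normalTerm (a b : ℤ → Module.End ℂ M) (n j : ℤ) : Module.End ℂ M :=
  if j < 0 then a j * b (n - j - 1) else b (n - j - 1) * a j

theorem normalOrder_eq (a b : ℤ → Module.End ℂ M) (n : ℤ) :
    normalOrder a b n = lfSum (normalTerm a b n) := rfl

variable {a b c a' b' : ℤ → Module.End ℂ M}

namespace IsField

theorem shift (ha : IsField a) (m : ℤ) : IsField (shiftField a m) := fun v => by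
  obtain ⟨N, hN⟩ := ha v
  exact ⟨N - m, fun n hn => hN _ (by linarith)⟩

theorem deriv (ha : IsField a) : IsField (derivField a) := fun v => by
  obtain ⟨N, hN⟩ := ha v
  exact ⟨N + 1, fun n hn => by simp [derivField, hN (n - 1) (by linarith)]⟩

theorem mono (c : ℂ) (m : ℤ) : IsField (monoField c m : ℤ → Module.End ℂ M) := fun v =>
  ⟨m + 1, fun n hn => by simp [monoField, show n ≠ m by omega]⟩

theorem zero : IsField (0 : ℤ → Module.End ℂ M) := fun v => ⟨0, fun n hn => by simp⟩

theorem add (ha : IsField a) (hb : IsField b) : IsField (a + b) := fun v => by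
  obtain ⟨N, hN⟩ := ha v
  obtain ⟨K, hK⟩ := hb v
  exact ⟨max N K, fun n hn => by simp [hN n (by omega), hK n (by omega)]⟩

theorem smul (r : ℂ) (ha : IsField a) : IsField (r • a) := fun v => by
  obtain ⟨N, hN⟩ := ha v
  exact ⟨N, fun n hn => by simp [hN n hn]⟩

theorem neg (ha : IsField a) : IsField (-a) := by
  simpa using ha.smul (-1)

theorem sub (ha : IsField a) (hb : IsField b) : IsField (a - b) := by
  simpa only [sub_eq_add_neg] using ha.add hb.neg

theorem mul_left (X : Module.End ℂ M) (ha : IsField a) : IsField (fun n => X * a n) := fun v => by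
  obtain ⟨N, hN⟩ := ha v
  exact ⟨N, fun n hn => by simp [hN n hn]⟩

/-- A field annihilates any finite family of vectors from some mode on. -/
theorem uniform (ha : IsField a) (w : ℤ → M) (p r : ℤ) :
    ∃ N : ℤ, ∀ i, p ≤ i → i < r → ∀ n ≥ N, a n (w i) = 0 := by
  choose K hK using fun v => ha v
  obtain ⟨N, hN⟩ := ((Finset.Ico p r).image fun i => K (w i)).exists_le
  exact ⟨N, fun i h1 h2 n hn => hK _ _
    ((hN _ (Finset.mem_image_of_mem _ (Finset.mem_Ico.2 ⟨h1, h2⟩))).trans hn)⟩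

theorem locallyFinite_normalTerm (ha : IsField a) (hb : IsField b) (n : ℤ) :
    LocallyFinite (normalTerm a b n) := by
  intro v
  obtain ⟨N, hN⟩ := ha v
  obtain ⟨K, hK⟩ := hb v
  refine (Set.finite_Ico (min (n - K) 0) (max N 0)).subset fun j hj => ?_
  by_contra hc
  apply hj
  simp only [Set.mem_Ico, not_and_or, not_le, not_lt] at hc
  simp only [normalTerm]
  split_ifs with h
  · simp [hK (n - j - 1) (by omega)]
  · simp [hN j (by omega)]

/-- On a given vector, all terms of the modes `n` of a normally ordered product vanish for `n` large,
uniformly in the summation index. -/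
theorem normalTerm_eventually_zero (ha : IsField a) (hb : IsField b) (v : M) :
    ∃ N : ℤ, ∀ n ≥ N, ∀ j, normalTerm a b n j v = 0 := by
  obtain ⟨N, hN⟩ := ha v
  obtain ⟨K, hK⟩ := hb v
  obtain ⟨R, hR⟩ := hb.uniform (fun j => a j v) 0 N
  refine ⟨max K (N + R), fun n hn j => ?_⟩
  simp only [normalTerm]
  split_ifs with h
  · simp [hK (n - j - 1) (by omega)]
  · by_cases hj : N ≤ j
    · simp [hN j hj]
    · exact hR j (by omega) (by omega) _ (by omega)

theorem normalOrder (ha : IsField a) (hb : IsField b) : IsField (normalOrder a b) := fun v => by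
  obtain ⟨N, hN⟩ := ha.normalTerm_eventually_zero hb v
  refine ⟨N, fun n hn => ?_⟩
  rw [normalOrder_eq, lfSum_apply (ha.locallyFinite_normalTerm hb n)]
  exact (finsum_congr fun j => hN n hn j).trans finsum_zero

end IsField

/-- An inner derivation acts on a normally ordered product by the Leibniz rule. -/
theorem normalOrder_bracket (X : Module.End ℂ M) (ha : IsField a) (hb : IsField b)
    (ha' : IsField a') (hb' : IsField b') (hXa : ∀ j, ⁅X, a j⁆ = a' j) (hXb : ∀ j, ⁅X, b j⁆ = b' j)
    (n : ℤ) : ⁅X, normalOrder a b n⁆ = normalOrder a' b n + normalOrder a b' n := by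
  simp only [normalOrder_eq]
  rw [bracket_lfSum X (ha.locallyFinite_normalTerm hb n),
    ← lfSum_add (ha'.locallyFinite_normalTerm hb n) (ha.locallyFinite_normalTerm hb' n)]
  congr 1
  ext1 j
  simp only [normalTerm]
  split_ifs
  · rw [bracket_mul, hXa, hXb]
  · rw [bracket_mul, hXa, hXb, add_comm]

theorem normalOrder_add_left (ha : IsField a) (ha' : IsField a') (hb : IsField b) (n : ℤ) :
    normalOrder (a + a') b n = normalOrder a b n + normalOrder a' b n := by
  simp only [normalOrder_eq]
  rw [← lfSum_add (ha.locallyFinite_normalTerm hb n) (ha'.locallyFinite_normalTerm hb n)]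
  congr 1
  ext1 j
  simp only [normalTerm, Pi.add_apply]
  split_ifs
  · rw [add_mul]
  · rw [mul_add]

theorem normalOrder_smul_left (r : ℂ) (ha : IsField a) (hb : IsField b) (n : ℤ) :
    normalOrder (r • a) b n = r • normalOrder a b n := by
  simp only [normalOrder_eq]
  rw [smul_lfSum r (ha.locallyFinite_normalTerm hb n)]
  congr 1
  ext1 j
  simp only [normalTerm, Pi.smul_apply]
  split_ifs <;> simp

theorem normalOrder_smul_right (r : ℂ) (ha : IsField a) (hb : IsField b) (n : ℤ) :
    normalOrder a (r • b) n = r • normalOrder a b n := by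
  simp only [normalOrder_eq]
  rw [smul_lfSum r (ha.locallyFinite_normalTerm hb n)]
  congr 1
  ext1 j
  simp only [normalTerm, Pi.smul_apply]
  split_ifs <;> simp

theorem normalOrder_zero_left (n : ℤ) : normalOrder 0 b n = 0 := by
  rw [normalOrder_eq, lfSum_eq_single 0] <;> simp [normalTerm]

theorem normalOrder_zero_right (n : ℤ) : normalOrder a 0 n = 0 := by
  rw [normalOrder_eq, lfSum_eq_single 0] <;> simp [normalTerm]

theorem normalOrder_mono_left (r : ℂ) (m n : ℤ) :
    normalOrder (monoField r m) b n = r • b (n - m - 1) := by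
  rw [normalOrder_eq, lfSum_eq_single m]
  · simp [normalTerm, monoField]
  · intro i hi
    simp [normalTerm, monoField, hi]

theorem normalOrder_mono_right (r : ℂ) (m n : ℤ) :
    normalOrder a (monoField r m) n = r • a (n - m - 1) := by
  rw [normalOrder_eq, lfSum_eq_single (n - m - 1)]
  · simp [normalTerm, monoField, show n - (n - m - 1) - 1 = m by ring]
  · intro i hi
    have : n - i - 1 ≠ m := by omega
    simp [normalTerm, monoField, this]

theorem normalOrder_comm (ha : IsField a) (hb : IsField b) (hab : ∀ i j, Commute (a i) (b j)) (n : ℤ) :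
    normalOrder a b n = normalOrder b a n := by
  have hb' := hb.locallyFinite_normalTerm ha n
  simp only [normalOrder_eq]
  rw [← lfSum_comp_equiv (Equiv.subLeft (n - 1)) hb']
  congr 1
  ext1 j
  simp only [normalTerm, Equiv.subLeft_apply, (hab _ _).eq, ite_self]
  rw [show n - (n - 1 - j) - 1 = j by ring, show n - j - 1 = n - 1 - j by ring]

theorem normalOrder_mul_right (X : Module.End ℂ M) (ha : IsField a) (hb : IsField b)
    (hX : ∀ j, Commute X (a j)) (n : ℤ) :
    normalOrder a (fun j => X * b j) n = X * normalOrder a b n := by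
  simp only [normalOrder_eq]
  rw [mul_lfSum X (ha.locallyFinite_normalTerm hb n)]
  congr 1
  ext1 j
  simp only [normalTerm]
  split_ifs
  · rw [← mul_assoc, ← mul_assoc, (hX _).eq]
  · rw [mul_assoc]

theorem commute_lfSum {X : Module.End ℂ M} {F : ι → Module.End ℂ M} (hF : LocallyFinite F)
    (h : ∀ i, Commute X (F i)) : Commute X (lfSum F) := by
  show _ = _
  rw [mul_lfSum X hF, lfSum_mul X hF]
  simp only [(h _).eq]

theorem commute_normalOrder {X : Module.End ℂ M} (ha : IsField a) (hb : IsField b)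
    (hXa : ∀ j, Commute X (a j)) (hXb : ∀ j, Commute X (b j)) (n : ℤ) :
    Commute X (normalOrder a b n) := by
  refine commute_lfSum (ha.locallyFinite_normalTerm hb n) fun j => ?_
  split_ifs
  · exact (hXa _).mul_right (hXb _)
  · exact (hXb _).mul_right (hXa _)

theorem normalOrder_shift_right (m n : ℤ) :
    normalOrder a (shiftField b m) n = normalOrder a b (n + m) := by
  simp only [normalOrder_eq]
  congr 1
  ext1 j
  simp only [normalTerm, shiftField, show n - j - 1 + m = n + m - j - 1 by ring]

theorem normalOrder_shift_one (ha : IsField a) (hb : IsField b) (n : ℤ) :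
    normalOrder (shiftField a 1) b n = normalOrder a b (n + 1) + ⁅a 0, b n⁆ := by
  have h1 := (ha.shift 1).locallyFinite_normalTerm hb n
  have h2 := (ha.locallyFinite_normalTerm hb (n + 1)).comp_injective (Equiv.addRight (1 : ℤ)).injective
  rw [← sub_eq_iff_eq_add', normalOrder_eq, normalOrder_eq,
    ← lfSum_comp_equiv (Equiv.addRight (1 : ℤ)) (ha.locallyFinite_normalTerm hb (n + 1)),
    ← lfSum_sub h1 h2, lfSum_eq_single (-1)]
  · simp [normalTerm, shiftField, Ring.lie_def]
  · intro j hj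
    simp only [Equiv.coe_addRight]
    simp only [normalTerm, shiftField]
    rw [show n + 1 - (j + 1) - 1 = n - j - 1 by ring]
    by_cases h : j < 0
    · rw [if_pos h, if_pos (by omega), sub_self]
    · rw [if_neg h, if_neg (by omega), sub_self]

/-- Shifting the first factor of a normally ordered product moves finitely many terms from one
ordering to the other. -/
theorem normalOrder_shift_left (ha : IsField a) (hb : IsField b) {K : Module.End ℂ M} (m n : ℤ)
    (hK : ∀ i, ⁅a i, b (n + m - 1 - i)⁆ = K) :
    normalOrder (shiftField a m) b n = normalOrder a b (n + m) + (m : ℂ) • K := by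
  have step : ∀ m n : ℤ, (∀ i, ⁅a i, b (n + m - i)⁆ = K) →
      normalOrder (shiftField a (m + 1)) b n = normalOrder (shiftField a m) b (n + 1) + K := by
    intro m n h
    rw [show shiftField a (m + 1) = shiftField (shiftField a m) 1 by
      ext1 j; simp only [shiftField]; congr 1; ring, normalOrder_shift_one (ha.shift m) hb,
      ← h m, add_sub_cancel_right]
    simp [shiftField]
  induction m using Int.induction_on generalizing n with
  | zero =>
    rw [show shiftField a 0 = a by ext1; simp [shiftField]]
    simp
  | succ m ih =>
    rw [step _ _ fun i => by rw [← hK i]; congr 2; ring, ih (n + 1) fun i => by rw [← hK i]; congr 2; ring,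
      show n + 1 + (m : ℤ) = n + (m + 1) by ring]
    push_cast
    module
  | pred m ih =>
    have := step (-m - 1) (n - 1) fun i => by rw [← hK i]; congr 2; ring
    rw [show (-m - 1 + 1 : ℤ) = -m by ring, ih (n - 1) fun i => by rw [← hK i]; congr 2; ring,
      sub_add_cancel, show n - 1 + -(m : ℤ) = n + (-m - 1) by ring, ← sub_eq_iff_eq_add] at this
    rw [← this]
    push_cast
    module

theorem normalOrder_shift_left_of_commute (ha : IsField a) (hb : IsField b)
    (hab : ∀ i j, Commute (a i) (b j)) (m n : ℤ) :
    normalOrder (shiftField a m) b n = normalOrder a b (n + m) := by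
  rw [normalOrder_shift_left ha hb (K := 0) m n fun i => (hab _ _).lie_eq, smul_zero, add_zero]

/-- The Leibniz rule for normally ordered products. -/
theorem derivField_normalOrder (ha : IsField a) (hb : IsField b) (n : ℤ) :
    derivField (normalOrder a b) n = normalOrder (derivField a) b n + normalOrder a (derivField b) n := by
  have hF := ha.locallyFinite_normalTerm hb (n - 1)
  have h1 := ha.deriv.locallyFinite_normalTerm hb n
  have h2 := ha.locallyFinite_normalTerm hb.deriv n
  have key : lfSum (fun j => normalTerm (derivField a) b n (j + 1) +
      ((-((n - j - 1 : ℤ) : ℂ)) • normalTerm a b (n - 1) j)) = derivField (normalOrder a b) n := by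
    rw [derivField, normalOrder_eq, smul_lfSum _ hF]
    congr 1
    ext1 j
    simp only [normalTerm, derivField, add_sub_cancel_right]
    -- The orderings of the two products differ only at `j = -1`, where the derivative has the factor `0`.
    rcases lt_trichotomy j (-1) with h | h | h
    · rw [if_pos (by omega), if_pos (by omega), show n - (j + 1) - 1 = n - 1 - j - 1 by ring]
      simp only [smul_mul_assoc]
      push_cast
      module
    · subst h
      simp
    · rw [if_neg (by omega), if_neg (by omega), show n - (j + 1) - 1 = n - 1 - j - 1 by ring]
      simp only [mul_smul_comm]
      push_cast
      module
  have e2 : normalTerm a (derivField b) n = fun j =>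
      (-((n - j - 1 : ℤ) : ℂ)) • normalTerm a b (n - 1) j := by
    ext1 j
    simp only [normalTerm, derivField, show n - j - 1 - 1 = n - 1 - j - 1 by ring]
    split_ifs
    · rw [mul_smul_comm]
    · rw [smul_mul_assoc]
  rw [← key, normalOrder_eq a, e2, normalOrder_eq, lfSum_add _ (e2 ▸ h2)]
  · rw [← lfSum_comp_equiv (Equiv.addRight (1 : ℤ)) h1]
    rfl
  · exact h1.comp_injective (Equiv.addRight (1 : ℤ)).injective

end Calculus

section Associativity

variable {M : Type*} [AddCommGroup M] [Module ℂ M] {a b c : ℤ → Module.End ℂ M}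

/-! ### Quasi-associativity of the normally ordered product -/

/-- The double family of terms of a normally ordered product whose left factor is itself one. -/
def nestedLeft (a b c : ℤ → Module.End ℂ M) (n : ℤ) (p : ℤ × ℤ) : Module.End ℂ M :=
  if p.1 < 0 then normalTerm a b p.1 p.2 * c (n - p.1 - 1)
  else c (n - p.1 - 1) * normalTerm a b p.1 p.2

/-- The double family of terms of a normally ordered product whose right factor is itself one. -/
def nestedRight (a b c : ℤ → Module.End ℂ M) (n : ℤ) (p : ℤ × ℤ) : Module.End ℂ M :=
  if p.1 < 0 then a p.1 * normalTerm b c (n - p.1 - 1) p.2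
  else normalTerm b c (n - p.1 - 1) p.2 * a p.1

theorem IsField.locallyFinite_nestedLeft (ha : IsField a) (hb : IsField b) (hc : IsField c) (n : ℤ) :
    LocallyFinite (nestedLeft a b c n) := by
  refine LocallyFinite.of_fibers (fun v => ?_) fun i => ?_
  · obtain ⟨N, hN⟩ := ha.normalTerm_eventually_zero hb v
    obtain ⟨K, hK⟩ := hc v
    refine (Set.finite_Ico (min (n - K) 0) (max N 0)).subset ?_
    rintro i ⟨j, hj⟩
    by_contra hi
    apply hj
    simp only [Set.mem_Ico, not_and_or, not_le, not_lt] at hi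
    simp only [nestedLeft]
    split_ifs with h
    · simp [hK (n - i - 1) (by omega)]
    · simp [hN i (by omega) j]
  · have h := ha.locallyFinite_normalTerm hb i
    simp only [nestedLeft]
    split_ifs
    · exact h.mul_right _
    · exact h.mul_left _

theorem normalOrder_normalOrder_left (ha : IsField a) (hb : IsField b) (hc : IsField c) (n : ℤ) :
    normalOrder (normalOrder a b) c n = lfSum (nestedLeft a b c n) := by
  rw [lfSum_curry (ha.locallyFinite_nestedLeft hb hc n), normalOrder_eq]
  congr 1
  ext1 i
  have h := ha.locallyFinite_normalTerm hb i
  show (if i < 0 then normalOrder a b i * c (n - i - 1) else c (n - i - 1) * normalOrder a b i) = _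
  simp only [nestedLeft]
  split_ifs
  · rw [normalOrder_eq, lfSum_mul _ h]
  · rw [normalOrder_eq, mul_lfSum _ h]

theorem IsField.locallyFinite_nestedRight (ha : IsField a) (hb : IsField b) (hc : IsField c) (n : ℤ) :
    LocallyFinite (nestedRight a b c n) := by
  refine LocallyFinite.of_fibers (fun v => ?_) fun i => ?_
  · obtain ⟨N, hN⟩ := ha v
    obtain ⟨K, hK⟩ := hb.normalTerm_eventually_zero hc v
    refine (Set.finite_Ico (min (n - K) 0) (max N 0)).subset ?_
    rintro i ⟨j, hj⟩
    by_contra hi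
    apply hj
    simp only [Set.mem_Ico, not_and_or, not_le, not_lt] at hi
    simp only [nestedRight]
    split_ifs with h
    · simp [hK (n - i - 1) (by omega)]
    · simp [hN i (by omega)]
  · have h := hb.locallyFinite_normalTerm hc (n - i - 1)
    simp only [nestedRight]
    split_ifs
    · exact h.mul_left _
    · exact h.mul_right _

theorem normalOrder_normalOrder_right (ha : IsField a) (hb : IsField b) (hc : IsField c) (n : ℤ) :
    normalOrder a (normalOrder b c) n = lfSum (nestedRight a b c n) := by
  rw [lfSum_curry (ha.locallyFinite_nestedRight hb hc n), normalOrder_eq]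
  congr 1
  ext1 i
  have h := hb.locallyFinite_normalTerm hc (n - i - 1)
  show (if i < 0 then a i * normalOrder b c (n - i - 1) else normalOrder b c (n - i - 1) * a i) = _
  simp only [nestedRight]
  split_ifs
  · rw [normalOrder_eq, mul_lfSum _ h]
  · rw [normalOrder_eq, lfSum_mul _ h]

/-- The sign with which a reordered pair of modes `i` and `i + s` contributes; the sum over all `i`
counts the lattice points between `0` and `-s`. -/
def crossingSign (s i : ℤ) : ℂ :=
  if 0 ≤ i ∧ i + s < 0 then 1 else if i < 0 ∧ 0 ≤ i + s then -1 else 0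

theorem finsum_crossingSign (s : ℤ) : ∑ᶠ i, crossingSign s i = -(s : ℂ) := by
  rcases le_total 0 s with hs | hs
  · rw [finsum_eq_finsetSum_of_support_subset _ (s := Finset.Ico (-s) 0), Finset.sum_congr rfl
      (g := fun _ => (-1 : ℂ)), Finset.sum_const]
    · rw [Int.card_Ico, zero_sub, neg_neg, nsmul_eq_mul, mul_neg, mul_one]
      congr 1
      exact_mod_cast congrArg (Int.cast (R := ℂ)) (Int.toNat_of_nonneg hs)
    · intro i hi
      rw [Finset.mem_Ico] at hi
      rw [crossingSign, if_neg (by omega), if_pos (by omega)]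
    · intro i hi
      by_contra hc
      simp only [Finset.coe_Ico, Set.mem_Ico] at hc
      apply hi
      rw [crossingSign, if_neg (by omega), if_neg (by omega)]
  · rw [finsum_eq_finsetSum_of_support_subset _ (s := Finset.Ico 0 (-s)), Finset.sum_congr rfl
      (g := fun _ => (1 : ℂ)), Finset.sum_const]
    · rw [Int.card_Ico, sub_zero, nsmul_eq_mul, mul_one]
      exact_mod_cast congrArg (Int.cast (R := ℂ)) (Int.toNat_of_nonneg (neg_nonneg.2 hs))
    · intro i hi
      rw [Finset.mem_Ico] at hi
      rw [crossingSign, if_pos (by omega)]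
    · intro i hi
      by_contra hc
      simp only [Finset.coe_Ico, Set.mem_Ico] at hc
      apply hi
      rw [crossingSign, if_neg (by omega), if_neg (by omega)]

/-- The index `(j, i)` of `nestedLeft` corresponds to the index `(i, j - i - 1)` of `nestedRight`. -/
def nestedEquiv : ℤ × ℤ ≃ ℤ × ℤ where
  toFun p := (p.2, p.1 - p.2 - 1)
  invFun p := (p.2 + p.1 + 1, p.1)
  left_inv p := Prod.ext (by dsimp only; ring) rfl
  right_inv p := Prod.ext rfl (by dsimp only; ring)

/-- The parametrization of pairs `(j, i)` by `(j - i, i)`. -/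
def shearEquiv : ℤ × ℤ ≃ ℤ × ℤ where
  toFun p := (p.1 + p.2, p.2)
  invFun p := (p.1 - p.2, p.2)
  left_inv p := by ext <;> simp
  right_inv p := by ext <;> simp

/-- Quasi-associativity: re-bracketing a normally ordered product produces the term `κ ∂b c` when
`a(z)` has a simple pole of residue `κ c(w)` with `c(w)`. The correction comes from the pairs of modes
whose order differs between the two bracketings. -/
theorem normalOrder_assoc (ha : IsField a) (hb : IsField b) (hc : IsField c) {κ : ℂ}
    (hbc : ∀ i j, Commute (b i) (c j)) (hac : ∀ i j, ⁅a i, c j⁆ = κ • c (i + j)) (n : ℤ) :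
    normalOrder (normalOrder a b) c n =
      normalOrder a (normalOrder b c) n + κ • normalOrder (derivField b) c n := by
  have hL := ha.locallyFinite_nestedLeft hb hc n
  have hR := (ha.locallyFinite_nestedRight hb hc n).comp_injective nestedEquiv.injective
  have hD := (hL.sub hR).comp_injective shearEquiv.injective
  -- A pair of modes contributes a commutator exactly when `i` and `j = s + i` have opposite signs.
  have hw : ∀ s i, nestedLeft a b c n (s + i, i) - nestedRight a b c n (i, s + i - i - 1) =
      (κ * crossingSign s i) • (b (s - 1) * c (n - s - 1)) := by
    intro s i
    have h1 : a i * c (n - (s + i) - 1) = c (n - (s + i) - 1) * a i + κ • c (n - s - 1) := by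
      rw [← sub_eq_iff_eq_add', ← Ring.lie_def, hac]
      congr 2
      ring
    have h2 := (hbc (s - 1) (n - (s + i) - 1)).eq
    have h3 := (hbc (s - 1) (n - s - 1)).eq
    simp only [nestedLeft, nestedRight, normalTerm, crossingSign]
    rw [show s + i - i - 1 = s - 1 by ring, show n - i - 1 - (s - 1) - 1 = n - (s + i) - 1 by ring, h2,
      ite_self]
    by_cases hi : i < 0 <;> by_cases hj : s + i < 0
    · rw [if_pos hi, if_pos hi, if_pos hj, if_neg (by omega), if_neg (by omega), mul_assoc, h2]
      simp
    · rw [if_pos hi, if_pos hi, if_neg hj, if_neg (by omega), if_pos (by omega), ← mul_assoc,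
        ← mul_assoc, h1, add_mul, smul_mul_assoc, h3]
      simp
    · rw [if_neg hi, if_neg hi, if_pos hj, if_pos (by omega), mul_assoc, h1, mul_add, ← mul_assoc, h2,
        mul_smul_comm]
      simp
    · rw [if_neg hi, if_neg hi, if_neg hj, if_neg (by omega), if_neg (by omega), ← mul_assoc]
      simp
  rw [normalOrder_normalOrder_left ha hb hc, normalOrder_normalOrder_right ha hb hc, ← sub_eq_iff_eq_add',
    ← lfSum_comp_equiv nestedEquiv (ha.locallyFinite_nestedRight hb hc n), ← lfSum_sub hL hR,
    ← lfSum_comp_equiv shearEquiv (hL.sub hR), lfSum_curry hD, normalOrder_eq,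
    smul_lfSum _ (hb.deriv.locallyFinite_normalTerm hc n)]
  congr 1
  ext s v
  have hin := hD.comp_injective (Prod.mk_right_injective s)
  rw [lfSum_apply hin]
  have e1 : normalTerm (derivField b) c n s = (-(s : ℂ)) • (b (s - 1) * c (n - s - 1)) := by
    simp only [normalTerm, derivField, smul_mul_assoc, mul_smul_comm, (hbc _ _).eq, ite_self]
  have e2 : ∀ i, (nestedLeft a b c n (shearEquiv (s, i)) - nestedRight a b c n
      (nestedEquiv (shearEquiv (s, i)))) v = crossingSign s i • κ • (b (s - 1) * c (n - s - 1)) v := by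
    intro i
    rw [smul_smul, mul_comm, ← LinearMap.smul_apply, ← hw s i]
    rfl
  rw [finsum_congr e2, ← finsum_smul, finsum_crossingSign, e1]
  simp only [LinearMap.smul_apply]
  rw [smul_comm]

end Associativity

section Exponentials

variable {M : Type*} [AddCommGroup M] [Module ℂ M]

/-! ### Exponentials of commuting modes -/

theorem coeff_pow_eq_zero_of_lt (u : ℕ → Module.End ℂ M) {j m : ℕ} (h : m < j) :
    PowerSeries.coeff m ((PowerSeries.mk fun n => if n = 0 then 0 else u n) ^ j) = 0 := by
  induction j generalizing m with
  | zero => omega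
  | succ j ih =>
    rw [pow_succ, PowerSeries.coeff_mul]
    refine Finset.sum_eq_zero fun p hp => ?_
    rw [Finset.HasAntidiagonal.mem_antidiagonal] at hp
    rw [PowerSeries.coeff_mk]
    split_ifs with h0
    · rw [mul_zero]
    · rw [ih (by omega), zero_mul]

theorem expCoeff_eq_sum (u : ℕ → Module.End ℂ M) {m N : ℕ} (h : m < N) :
    expCoeff u m = ∑ j ∈ Finset.range N, ((j.factorial : ℂ)⁻¹) •
      PowerSeries.coeff m ((PowerSeries.mk fun n => if n = 0 then 0 else u n) ^ j) := by
  rw [expCoeff]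
  refine Finset.sum_subset (Finset.range_subset_range.2 h) fun j _ hj => ?_
  rw [Finset.mem_range, not_lt] at hj
  rw [coeff_pow_eq_zero_of_lt u (by omega), smul_zero]

theorem expCoeff_zero (u : ℕ → Module.End ℂ M) : expCoeff u 0 = 1 := by
  simp [expCoeff]

/-- A derivation `d` of the algebra of power series which acts coefficientwise satisfies
`d (exp U) = dU exp U`, as soon as `dU` commutes with `U`. -/
theorem derivation_expCoeff (d : ℕ → Module.End ℂ M →ₗ[ℂ] Module.End ℂ M)
    (hd : ∀ i j x y, d (i + j) (x * y) = d i x * y + x * d j y) (u : ℕ → Module.End ℂ M)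
    (hu : ∀ i j, i ≠ 0 → Commute (d i (u i)) (u j)) (m : ℕ) :
    d m (expCoeff u m) =
      ∑ i ∈ Finset.range (m + 1), (if i = 0 then 0 else d i (u i)) * expCoeff u (m - i) := by
  set U : PowerSeries (Module.End ℂ M) := PowerSeries.mk fun n => if n = 0 then 0 else u n with hU
  let dd : PowerSeries (Module.End ℂ M) → PowerSeries (Module.End ℂ M) :=
    fun F => PowerSeries.mk fun m => d m (PowerSeries.coeff m F)
  have dd_mul : ∀ F G, dd (F * G) = dd F * G + F * dd G := by
    intro F G
    ext1 m
    simp only [dd, map_add, PowerSeries.coeff_mul, PowerSeries.coeff_mk, map_sum]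
    rw [← Finset.sum_add_distrib]
    refine Finset.sum_congr rfl fun p hp => ?_
    rw [← hd, Finset.HasAntidiagonal.mem_antidiagonal.1 hp]
  have dd_U : ∀ i, PowerSeries.coeff i (dd U) = if i = 0 then 0 else d i (u i) := by
    intro i
    simp only [dd, hU, PowerSeries.coeff_mk]
    split_ifs with h
    · rw [map_zero]
    · rfl
  have comm : Commute (dd U) U := by
    show _ = _
    ext1 m
    rw [PowerSeries.coeff_mul, PowerSeries.coeff_mul, ← Finset.Nat.sum_antidiagonal_swap]
    refine Finset.sum_congr rfl fun p _ => ?_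
    rw [dd_U, dd_U]
    simp only [Prod.fst_swap, Prod.snd_swap, hU, PowerSeries.coeff_mk]
    split_ifs with h1 h2
    · simp
    · simp
    · simp
    · exact (hu _ _ h1).eq
  have dd_pow : ∀ j : ℕ, dd (U ^ (j + 1)) = ((j : ℂ) + 1) • (dd U * U ^ j) := by
    intro j
    induction j with
    | zero => simp
    | succ j ih =>
      rw [pow_succ, dd_mul, ih, smul_mul_assoc, mul_assoc, ← pow_succ, ← (comm.pow_right (j + 1)).eq]
      push_cast
      module
  have dd_one : dd (U ^ 0) = 0 := by
    have := dd_mul 1 1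
    rw [one_mul, mul_one, left_eq_add, one_mul] at this
    rw [pow_zero, this]
  have coeff_dd : ∀ F, PowerSeries.coeff m (dd F) = d m (PowerSeries.coeff m F) := fun F =>
    PowerSeries.coeff_mk _ _
  rw [expCoeff, map_sum, Finset.sum_range_succ']
  simp only [map_smul, ← hU, ← coeff_dd, dd_one, dd_pow, map_zero, smul_zero, add_zero]
  have h1 : ∀ j : ℕ, (((j + 1).factorial : ℂ)⁻¹) • ((j : ℂ) + 1) • PowerSeries.coeff m (dd U * U ^ j) =
      ∑ i ∈ Finset.range (m + 1), (if i = 0 then 0 else d i (u i)) *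
        (((j.factorial : ℂ)⁻¹) • PowerSeries.coeff (m - i) (U ^ j)) := by
    intro j
    rw [smul_smul, Nat.factorial_succ, Nat.cast_mul, mul_inv, mul_right_comm, Nat.cast_add, Nat.cast_one,
      inv_mul_cancel₀ (Nat.cast_add_one_ne_zero j), one_mul, PowerSeries.coeff_mul,
      Finset.Nat.sum_antidiagonal_eq_sum_range_succ_mk, Finset.smul_sum]
    refine Finset.sum_congr rfl fun i _ => ?_
    rw [dd_U, mul_smul_comm]
  have h2 : ∀ j : ℕ, PowerSeries.coeff m (((j : ℂ) + 1) • (dd U * U ^ j)) =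
      ((j : ℂ) + 1) • PowerSeries.coeff m (dd U * U ^ j) := fun j => rfl
  rw [Finset.sum_congr rfl fun j _ => (congrArg _ (h2 j)).trans (h1 j), Finset.sum_comm]
  refine Finset.sum_congr rfl fun i hi => ?_
  split_ifs with h
  · simp
  · rw [← Finset.mul_sum, expCoeff_eq_sum u (show m - i < m by rw [Finset.mem_range] at hi; omega)]

/-- The recursion `m Eₘ = ∑ᵢ i uᵢ Eₘ₋ᵢ` for the coefficients of an exponential, from the Euler
derivation `z d/dz`. -/
theorem nat_smul_expCoeff (u : ℕ → Module.End ℂ M) (hu : ∀ i j, Commute (u i) (u j)) (m : ℕ) :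
    (m : ℂ) • expCoeff u m =
      ∑ i ∈ Finset.range (m + 1), ((i : ℂ) • u i) * expCoeff u (m - i) := by
  have := derivation_expCoeff (fun i => (i : ℂ) • LinearMap.id) (fun i j x y => by
    simp only [LinearMap.smul_apply, LinearMap.id_apply, smul_mul_assoc, mul_smul_comm]
    push_cast
    module) u (fun i j _ => by simpa using (hu i j).smul_left _) m
  simp only [LinearMap.smul_apply, LinearMap.id_apply] at this
  rw [this]
  refine Finset.sum_congr rfl fun i _ => ?_
  split_ifs with h
  · simp [h]
  · rfl

theorem bracket_expCoeff (X : Module.End ℂ M) (u : ℕ → Module.End ℂ M) {κ : ℂ} {n : ℕ} (hn : n ≠ 0)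
    (hX : ∀ i, i ≠ 0 → ⁅X, u i⁆ = if i = n then κ • 1 else 0) (m : ℕ) :
    ⁅X, expCoeff u m⁆ = if n ≤ m then κ • expCoeff u (m - n) else 0 := by
  have := derivation_expCoeff (fun _ => LinearMap.mulLeft ℂ X - LinearMap.mulRight ℂ X)
    (fun i j x y => by
      simp only [LinearMap.sub_apply, LinearMap.mulLeft_apply, LinearMap.mulRight_apply]
      noncomm_ring) u (fun i j h => by
      simp only [LinearMap.sub_apply, LinearMap.mulLeft_apply, LinearMap.mulRight_apply,
        ← Ring.lie_def, hX i h]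
      split_ifs
      · exact (Commute.one_left _).smul_left _
      · exact Commute.zero_left _) m
  simp only [LinearMap.sub_apply, LinearMap.mulLeft_apply, LinearMap.mulRight_apply,
    ← Ring.lie_def] at this
  rw [this]
  split_ifs with h
  · rw [Finset.sum_eq_single n]
    · rw [if_neg hn, hX n hn, if_pos rfl, smul_mul_assoc, one_mul]
    · intro i _ hi
      split_ifs with h0
      · rw [zero_mul]
      · rw [hX i h0, if_neg hi, zero_mul]
    · intro h'
      rw [Finset.mem_range] at h'
      omega
  · refine Finset.sum_eq_zero fun i hi => ?_
    rw [Finset.mem_range] at hi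
    split_ifs with h0
    · rw [zero_mul]
    · rw [hX i h0, if_neg (by omega), zero_mul]

theorem commute_expCoeff {X : Module.End ℂ M} {u : ℕ → Module.End ℂ M}
    (hX : ∀ i, i ≠ 0 → Commute X (u i)) (m : ℕ) : Commute X (expCoeff u m) := by
  have := bracket_expCoeff X u (κ := 0) one_ne_zero (fun i hi => by simp [(hX i hi).lie_eq]) m
  rw [zero_smul, ite_self] at this
  exact sub_eq_zero.1 this

theorem lfSum_eq_sum_range {F : ℤ → Module.End ℂ M} {e : ℕ → ℤ} (he : Injective e) (m : ℕ)
    (h : ∀ j, (∀ i ≤ m, j ≠ e i) → F j = 0) :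
    lfSum F = ∑ i ∈ Finset.range (m + 1), F (e i) := by
  have hs : ∀ v, (support fun i => F i v) ⊆ ((Finset.range (m + 1)).map ⟨e, he⟩ : Finset ℤ) := by
    intro v j hj
    by_contra hc
    apply hj
    simp only [Finset.coe_map, Embedding.coeFn_mk, Set.mem_image, Finset.coe_range, Set.mem_Iio,
      not_exists, not_and] at hc
    show F j v = 0
    rw [h j fun i hi hji => hc i (by omega) hji.symm, LinearMap.zero_apply]
  have hF : LocallyFinite F := fun v => (Finset.finite_toSet _).subset (hs v)
  ext v
  rw [lfSum_apply hF, finsum_eq_finsetSum_of_support_subset _ (hs v), Finset.sum_map,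
    LinearMap.sum_apply]
  rfl

/-- The modes of `exp (∑ₙ uₙ zⁿ)`. The mode `n`, the coefficient of `z⁻ⁿ⁻¹`, is non-zero only for
`n < 0`. -/
def creationExp (u : ℕ → Module.End ℂ M) (n : ℤ) : Module.End ℂ M :=
  if n < 0 then expCoeff u (-n - 1).toNat else 0

/-- The modes of `exp (∑ₙ uₙ z⁻ⁿ)`. The constant term of this field is its mode `-1`. -/
def annihilationExp (u : ℕ → Module.End ℂ M) (n : ℤ) : Module.End ℂ M :=
  if -1 ≤ n then expCoeff u (n + 1).toNat else 0

/-- The part of a field with modes of negative index. -/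
def creationPart (d : ℤ → Module.End ℂ M) (n : ℤ) : Module.End ℂ M := if n < 0 then d n else 0

/-- The part of a field with modes of non-negative index. -/
def annihilationPart (d : ℤ → Module.End ℂ M) (n : ℤ) : Module.End ℂ M := if n < 0 then 0 else d n

/-- The coefficients `ε δ₍₋ₙ₎ / n` of the exponent of the creation factor. The value at
`n = 0`, where the quotient is `0`, plays no role in `expCoeff`. -/
def creationExponent (d : ℤ → Module.End ℂ M) (ε : ℤ) (i : ℕ) : Module.End ℂ M :=
  ((ε : ℂ) / (i : ℂ)) • d (-(i : ℤ))

/-- The coefficients `-ε δ₍ₙ₎ / n` of the exponent of the annihilation factor. The value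
at `n = 0`, where the quotient is `0`, plays no role in `expCoeff`. -/
def annihilationExponent (d : ℤ → Module.End ℂ M) (ε : ℤ) (i : ℕ) : Module.End ℂ M :=
  (-((ε : ℂ) / (i : ℂ))) • d (i : ℤ)

theorem creationPart_add_annihilationPart (d : ℤ → Module.End ℂ M) :
    creationPart d + annihilationPart d = d := by
  ext1 n
  simp only [Pi.add_apply, creationPart, annihilationPart]
  split_ifs <;> simp

theorem isField_creationExp (u : ℕ → Module.End ℂ M) : IsField (creationExp u) := fun v =>
  ⟨0, fun n hn => by simp [creationExp, not_lt.2 hn]⟩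

theorem isField_creationPart (d : ℤ → Module.End ℂ M) : IsField (creationPart d) := fun v =>
  ⟨0, fun n hn => by simp [creationPart, not_lt.2 hn]⟩

theorem IsField.annihilationPart {d : ℤ → Module.End ℂ M} (hd : IsField d) :
    IsField (annihilationPart d) := fun v => by
  obtain ⟨N, hN⟩ := hd v
  refine ⟨N, fun n hn => ?_⟩
  simp only [Wakimoto.annihilationPart]
  split_ifs
  · rfl
  · exact hN n hn

variable {d : ℤ → Module.End ℂ M}

theorem derivField_creationExp (hd : ∀ i j, Commute (d i) (d j)) (ε : ℤ) (n : ℤ) :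
    derivField (creationExp (creationExponent d ε)) n =
      (ε : ℂ) • normalOrder (creationPart d) (creationExp (creationExponent d ε)) n := by
  rcases le_or_gt 0 n with hn | hn
  · rw [normalOrder_eq, lfSum_eq_single 0]
    · rcases hn.eq_or_lt with rfl | hn
      · simp [derivField, normalTerm, creationPart]
      · simp [derivField, normalTerm, creationPart, creationExp, show ¬ n - 1 < 0 by omega]
    · intro j _
      rcases lt_or_ge j 0 with hj | hj
      · simp [normalTerm, creationExp, hj, show ¬ n - j - 1 < 0 by omega]
      · simp [normalTerm, creationPart, not_lt.2 hj]
  · obtain ⟨m, rfl⟩ : ∃ m : ℕ, n = -m := ⟨n.natAbs, by omega⟩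
    rw [normalOrder_eq, lfSum_eq_sum_range (e := fun i => -(i : ℤ)) (fun i j h => by simpa using h) m,
      Finset.smul_sum, derivField, creationExp, if_pos (by omega),
      show (-(-(m : ℤ) - 1) - 1).toNat = m by omega]
    · rw [show (-((-(m : ℤ) : ℤ) : ℂ)) = (m : ℂ) by push_cast; ring, nat_smul_expCoeff]
      · refine Finset.sum_congr rfl fun i hi => ?_
        rw [Finset.mem_range] at hi
        rcases Nat.eq_zero_or_pos i with rfl | hi0
        · simp [normalTerm, creationPart]
        · rw [normalTerm, if_pos (by omega), creationPart, if_pos (by omega), creationExp,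
            if_pos (by omega), show (-(-(m : ℤ) - -(i : ℤ) - 1) - 1).toNat = m - i by omega,
            creationExponent, smul_smul, mul_div_cancel₀ _ (Nat.cast_ne_zero.2 hi0.ne'), smul_mul_assoc]
      · exact fun i j => ((hd _ _).smul_left _).smul_right _
    · intro j hj
      rcases lt_or_ge j 0 with hj0 | hj0
      · have : ¬ j ≥ -m := fun h => hj j.natAbs (by omega) (by omega)
        simp [normalTerm, creationExp, hj0, show ¬ -(m : ℤ) - j - 1 < 0 by omega]
      · simp [normalTerm, creationPart, not_lt.2 hj0]

theorem derivField_annihilationExp (hd : ∀ i j, Commute (d i) (d j)) (hd0 : d 0 = 0) (ε : ℤ) (n : ℤ) :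
    derivField (annihilationExp (annihilationExponent d ε)) n =
      (ε : ℂ) • normalOrder (annihilationPart d) (annihilationExp (annihilationExponent d ε)) n := by
  have hu : ∀ i j, Commute (annihilationExponent d ε i) (annihilationExponent d ε j) :=
    fun i j => ((hd _ _).smul_left _).smul_right _
  rcases lt_or_ge n 0 with hn | hn
  · rw [normalOrder_eq, lfSum_eq_single 0]
    · simp [derivField, normalTerm, annihilationPart, annihilationExp, hd0, show ¬ -1 < n by omega]
    · intro j _
      rcases lt_or_ge j 0 with hj | hj
      · simp [normalTerm, annihilationPart, hj]
      · simp [normalTerm, annihilationExp, not_lt.2 hj, show ¬ -1 ≤ n - j - 1 by omega]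
  · lift n to ℕ using hn
    rw [normalOrder_eq, lfSum_eq_sum_range (e := fun i => (i : ℤ)) (fun i j h => by simpa using h) n,
      Finset.smul_sum, derivField, annihilationExp, if_pos (by omega),
      show ((n : ℤ) - 1 + 1).toNat = n by omega]
    · rw [neg_smul, Int.cast_natCast, nat_smul_expCoeff _ hu, ← Finset.sum_neg_distrib]
      refine Finset.sum_congr rfl fun i hi => ?_
      rw [Finset.mem_range] at hi
      rcases Nat.eq_zero_or_pos i with rfl | hi0
      · simp [normalTerm, annihilationPart, hd0]
      · rw [normalTerm, if_neg (by omega), annihilationPart, if_neg (by omega), annihilationExp,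
          if_pos (by omega), show ((n : ℤ) - (i : ℤ) - 1 + 1).toNat = n - i by omega]
        have hc : Commute (d i) (expCoeff (annihilationExponent d ε) (n - i)) :=
          commute_expCoeff (fun j _ => (hd _ _).smul_right _) _
        rw [← hc.eq, annihilationExponent, smul_smul, mul_neg,
          mul_div_cancel₀ _ (Nat.cast_ne_zero.2 hi0.ne'), smul_mul_assoc, neg_smul, neg_neg]
    · intro j hj
      rcases lt_or_ge j 0 with hj0 | hj0
      · simp [normalTerm, annihilationPart, hj0]
      · have : ¬ j ≤ n := fun h => hj j.natAbs (by omega) (by omega)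
        simp [normalTerm, annihilationExp, not_lt.2 hj0, show ¬ -1 ≤ n - j - 1 by omega]

/-- The commutation relations `[a₍ₘ₎, b₍ₙ₎] = m κ δ_{m+n,0}` of two Heisenberg fields. -/
def HeisenbergPair (a b : ℤ → Module.End ℂ M) (κ : ℂ) : Prop :=
  ∀ m n, ⁅a m, b n⁆ = if m + n = 0 then ((m : ℂ) * κ) • 1 else 0

theorem HeisenbergPair.symm {a b : ℤ → Module.End ℂ M} {κ : ℂ} (h : HeisenbergPair a b κ) :
    HeisenbergPair b a κ := by
  intro m n
  rw [← bracket_skew, h, add_comm n m]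
  split_ifs with h0
  · rw [eq_neg_of_add_eq_zero_right h0]
    push_cast
    module
  · simp

variable {a : ℤ → Module.End ℂ M} {κ : ℂ}

theorem HeisenbergPair.bracket_creationExp (h : HeisenbergPair a d κ) (ε m n : ℤ) :
    ⁅a m, creationExp (creationExponent d ε) n⁆ =
      if 0 < m then ((ε : ℂ) * κ) • creationExp (creationExponent d ε) (n + m) else 0 := by
  have hX : ∀ i : ℕ, i ≠ 0 → ⁅a m, creationExponent d ε i⁆ = if (i : ℤ) = m then ((ε : ℂ) * κ) • 1 else 0 := by
    intro i hi
    rw [creationExponent, bracket_smul, h]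
    split_ifs with h1 h2 h2
    · rw [← h2, smul_smul]
      congr 1
      push_cast
      field_simp
    · omega
    · omega
    · simp
  simp only [creationExp]
  by_cases hn : n < 0
  · rw [if_pos hn]
    by_cases hm : 0 < m
    · lift m to ℕ using hm.le
      simp only [Nat.cast_inj] at hX
      rw [bracket_expCoeff (a m) _ (by omega) hX, if_pos hm]
      by_cases h1 : n + m < 0
      · rw [if_pos h1, if_pos (by omega)]
        congr 2
        omega
      · rw [if_neg h1, if_neg (by omega), smul_zero]
    · rw [if_neg hm]
      refine (commute_expCoeff (fun i hi => ?_) _).lie_eq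
      have := hX i hi
      rw [if_neg (by omega)] at this
      exact sub_eq_zero.1 this
  · rw [if_neg hn, bracket_zero]
    split_ifs
    · omega
    · simp
    · rfl

theorem HeisenbergPair.bracket_annihilationExp (h : HeisenbergPair a d κ) (ε m n : ℤ) :
    ⁅a m, annihilationExp (annihilationExponent d ε) n⁆ =
      if m < 0 then ((ε : ℂ) * κ) • annihilationExp (annihilationExponent d ε) (n + m) else 0 := by
  have hX : ∀ i : ℕ, i ≠ 0 → ⁅a m, annihilationExponent d ε i⁆ =
      if -(i : ℤ) = m then ((ε : ℂ) * κ) • 1 else 0 := by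
    intro i hi
    rw [annihilationExponent, bracket_smul, h]
    split_ifs with h1 h2 h2
    · rw [← h2, smul_smul]
      congr 1
      push_cast
      field_simp
    · omega
    · omega
    · simp
  simp only [annihilationExp]
  by_cases hn : -1 ≤ n
  · rw [if_pos hn]
    by_cases hm : m < 0
    · obtain ⟨m, rfl⟩ : ∃ k : ℕ, m = -k := ⟨m.natAbs, by omega⟩
      simp only [neg_inj, Nat.cast_inj] at hX
      rw [bracket_expCoeff (a _) _ (by omega) hX, if_pos hm]
      by_cases h1 : -1 ≤ n + -(m : ℤ)
      · rw [if_pos h1, if_pos (by omega)]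
        congr 2
        omega
      · rw [if_neg h1, if_neg (by omega), smul_zero]
    · rw [if_neg hm]
      refine (commute_expCoeff (fun i hi => ?_) _).lie_eq
      have := hX i hi
      rw [if_neg (by omega)] at this
      exact sub_eq_zero.1 this
  · rw [if_neg hn, bracket_zero]
    split_ifs
    · omega
    · simp
    · rfl

end Exponentials

section FockSpace

variable {M : Type*} [AddCommGroup M] [Module ℂ M]

/-! ### Fock spaces and their vertex operators -/

/-- The relations `[a₍ₘ₎, qᵉ] = δ_{m,0} e κ qᵉ`, where `κ = (a, δ)`. -/
def Charged (D : FockModes M) (a : ℤ → Module.End ℂ M) (κ : ℂ) : Prop :=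
  ∀ m ε, ⁅a m, D.q ε⁆ = if m = 0 then ((ε : ℂ) * κ) • D.q ε else 0

/-- The relations of the Heisenberg fields with Gram matrix
`(α,α) = (γ,γ) = 1`, `(α,γ) = c`, `(α,δ) = 1`, `(γ,δ) = -1`, `(δ,δ) = 0`, on a space which the modes of
negative index and the operators `qᵉ` generate from the vacuum vector. -/
structure IsFock (D : FockModes M) (c : ℂ) : Prop where
  αα : HeisenbergPair D.α D.α 1
  γγ : HeisenbergPair D.γ D.γ 1
  αγ : HeisenbergPair D.α D.γ c
  αδ : HeisenbergPair D.α D.δ 1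
  γδ : HeisenbergPair D.γ D.δ (-1)
  δδ : HeisenbergPair D.δ D.δ 0
  charged_α : Charged D D.α 1
  charged_γ : Charged D D.γ (-1)
  charged_δ : Charged D D.δ 0
  δ_zero : D.δ 0 = 0
  q_zero : D.q 0 = 1
  q_add : ∀ ε η, D.q (ε + η) = D.q ε * D.q η
  α_vac : ∀ n ≥ 0, D.α n D.vac = 0
  γ_vac : ∀ n ≥ 0, D.γ n D.vac = 0
  δ_vac : ∀ n ≥ 0, D.δ n D.vac = 0
  cyclic : ∀ W : Submodule ℂ M, D.vac ∈ W → (∀ n < 0, ∀ w ∈ W, D.α n w ∈ W) →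
    (∀ n < 0, ∀ w ∈ W, D.γ n w ∈ W) → (∀ n < 0, ∀ w ∈ W, D.δ n w ∈ W) →
    (∀ ε, ∀ w ∈ W, D.q ε w ∈ W) → ∀ v, v ∈ W

/-- The brackets of `X` with the modes of `A` of large index are multiples, by a constant, of shifted
modes of `A`. -/
def ShiftsModes (X : Module.End ℂ M) (A : ℤ → Module.End ℂ M) : Prop :=
  ∃ (s : ℤ) (κ : ℂ) (N : ℤ), ∀ n ≥ N, ⁅X, A n⁆ = κ • A (n + s)

variable {a b d A : ℤ → Module.End ℂ M} {κ c : ℂ} {D : FockModes M}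

theorem HeisenbergPair.shiftsModes (h : HeisenbergPair a b κ) (m : ℤ) : ShiftsModes (a m) b :=
  ⟨0, 0, -m + 1, fun n hn => by rw [h, if_neg (by omega), zero_smul]⟩

theorem Charged.shiftsModes (h : Charged D a κ) (ε : ℤ) : ShiftsModes (D.q ε) a :=
  ⟨0, 0, 1, fun n hn => by rw [← bracket_skew, h, if_neg (by omega), zero_smul, neg_zero]⟩

namespace IsFock

/-- The field property propagates from the vacuum to the whole Fock space. -/
theorem isField_of_shiftsModes (hD : IsFock D c) (hvac : ∃ N : ℤ, ∀ n ≥ N, A n D.vac = 0)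
    (hα : ∀ m < 0, ShiftsModes (D.α m) A) (hγ : ∀ m < 0, ShiftsModes (D.γ m) A)
    (hδ : ∀ m < 0, ShiftsModes (D.δ m) A) (hq : ∀ ε, ShiftsModes (D.q ε) A) : IsField A := by
  let W : Submodule ℂ M :=
    { carrier := {v | ∃ N : ℤ, ∀ n ≥ N, A n v = 0}
      add_mem' := by
        rintro v w ⟨N, hN⟩ ⟨K, hK⟩
        exact ⟨max N K, fun n hn => by rw [map_add, hN n (by omega), hK n (by omega), add_zero]⟩
      zero_mem' := ⟨0, fun n _ => map_zero _⟩
      smul_mem' := by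
        rintro r v ⟨N, hN⟩
        exact ⟨N, fun n hn => by rw [map_smul, hN n hn, smul_zero]⟩ }
  have step : ∀ X, ShiftsModes X A → ∀ w ∈ W, X w ∈ W := by
    rintro X ⟨s, κ, N, hX⟩ w ⟨K, hK⟩
    refine ⟨max N (max K (K - s)), fun n hn => ?_⟩
    have h := LinearMap.congr_fun (hX n (by omega)) w
    rw [Ring.lie_def, LinearMap.sub_apply, Module.End.mul_apply, Module.End.mul_apply,
      LinearMap.smul_apply, hK n (by omega), hK (n + s) (by omega), map_zero, smul_zero, zero_sub,
      neg_eq_zero] at h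
    exact h
  exact fun v => hD.cyclic W hvac (fun n hn => step _ (hα n hn)) (fun n hn => step _ (hγ n hn))
    (fun n hn => step _ (hδ n hn)) (fun ε => step _ (hq ε)) v

theorem isField_α (hD : IsFock D c) : IsField D.α :=
  hD.isField_of_shiftsModes ⟨0, hD.α_vac⟩ (fun m _ => hD.αα.shiftsModes m)
    (fun m _ => hD.αγ.symm.shiftsModes m) (fun m _ => hD.αδ.symm.shiftsModes m)
    hD.charged_α.shiftsModes

theorem isField_γ (hD : IsFock D c) : IsField D.γ :=
  hD.isField_of_shiftsModes ⟨0, hD.γ_vac⟩ (fun m _ => hD.αγ.shiftsModes m)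
    (fun m _ => hD.γγ.shiftsModes m) (fun m _ => hD.γδ.symm.shiftsModes m)
    hD.charged_γ.shiftsModes

theorem isField_δ (hD : IsFock D c) : IsField D.δ :=
  hD.isField_of_shiftsModes ⟨0, hD.δ_vac⟩ (fun m _ => hD.αδ.shiftsModes m)
    (fun m _ => hD.γδ.shiftsModes m) (fun m _ => hD.δδ.shiftsModes m)
    hD.charged_δ.shiftsModes

theorem commute_δ (hD : IsFock D c) (i j : ℤ) : Commute (D.δ i) (D.δ j) := by
  have := hD.δδ i j
  rw [mul_zero, zero_smul, ite_self] at this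
  exact sub_eq_zero.1 this

theorem commute_q_δ (hD : IsFock D c) (ε j : ℤ) : Commute (D.q ε) (D.δ j) := by
  have := hD.charged_δ j ε
  rw [mul_zero, zero_smul, ite_self] at this
  exact (sub_eq_zero.1 this : Commute _ _).symm

theorem commute_q (hD : IsFock D c) (ε η : ℤ) : Commute (D.q ε) (D.q η) := by
  show _ = _
  rw [← hD.q_add, ← hD.q_add, add_comm]

end IsFock

theorem commute_creationExp {X : Module.End ℂ M} (h : ∀ i, Commute X (d i)) (ε n : ℤ) :
    Commute X (creationExp (creationExponent d ε) n) := by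
  rw [creationExp]
  split_ifs
  · exact commute_expCoeff (fun i _ => (h _).smul_right _) _
  · exact Commute.zero_right _

theorem commute_annihilationExp {X : Module.End ℂ M} (h : ∀ i, Commute X (d i)) (ε n : ℤ) :
    Commute X (annihilationExp (annihilationExponent d ε) n) := by
  rw [annihilationExp]
  split_ifs
  · exact commute_expCoeff (fun i _ => (h _).smul_right _) _
  · exact Commute.zero_right _

theorem annihilationExp_apply_eq_zero (hd : ∀ i j, Commute (d i) (d j)) {v : M}
    (hv : ∀ n ≥ 0, d n v = 0) (ε : ℤ) (n : ℤ) (hn : 0 ≤ n) :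
    annihilationExp (annihilationExponent d ε) n v = 0 := by
  have hu : ∀ i j, Commute (annihilationExponent d ε i) (annihilationExponent d ε j) :=
    fun i j => ((hd _ _).smul_left _).smul_right _
  rw [annihilationExp, if_pos (by omega)]
  have hm : (((n + 1).toNat : ℕ) : ℂ) ≠ 0 := Nat.cast_ne_zero.2 (by omega)
  rw [← smul_eq_zero_iff_right hm, ← LinearMap.smul_apply, nat_smul_expCoeff _ hu, LinearMap.sum_apply]
  refine Finset.sum_eq_zero fun i _ => ?_
  rw [((commute_expCoeff (fun j _ => hu i j) _).smul_left (i : ℂ)).eq, Module.End.mul_apply,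
    annihilationExponent]
  simp [hv i (by omega)]

theorem lfSum_comp_injective {ι κ : Type*} {F : ι → Module.End ℂ M} (hF : LocallyFinite F) {e : κ → ι}
    (he : Injective e) (h : ∀ i, i ∉ Set.range e → F i = 0) : lfSum (fun j => F (e j)) = lfSum F := by
  ext v
  rw [lfSum_apply hF, lfSum_apply (hF.comp_injective he), ← finsum_mem_range (f := fun i => F i v) he]
  refine finsum_congr fun i => ?_
  by_cases hi : i ∈ Set.range e
  · simp only [hi, finsum_true]
  · simp only [h i hi, LinearMap.zero_apply, finsum_zero]

namespace IsFock

theorem isField_annihilationExp (hD : IsFock D c) (ε : ℤ) :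
    IsField (annihilationExp (annihilationExponent D.δ ε)) := by
  have key : ∀ {a : ℤ → Module.End ℂ M} {κ : ℂ}, HeisenbergPair a D.δ κ → ∀ m < 0,
      ShiftsModes (a m) (annihilationExp (annihilationExponent D.δ ε)) := fun h m hm =>
    ⟨m, _, 0, fun n _ => by rw [h.bracket_annihilationExp, if_pos hm]⟩
  refine hD.isField_of_shiftsModes
    ⟨0, fun n hn => annihilationExp_apply_eq_zero hD.commute_δ hD.δ_vac ε n hn⟩
    (key hD.αδ) (key hD.γδ) (key hD.δδ) fun η => ⟨0, 0, 0, fun n _ => ?_⟩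
  rw [zero_smul, (commute_annihilationExp (hD.commute_q_δ η) ε n).lie_eq]

theorem commute_creationExp_annihilationExp (hD : IsFock D c) (ε η i j : ℤ) :
    Commute (creationExp (creationExponent D.δ ε) i)
      (annihilationExp (annihilationExponent D.δ η) j) :=
  commute_annihilationExp (fun l => (commute_creationExp (hD.commute_δ l) ε i).symm) η j

/-- The vertex operator `e^{εδ}(z)` is `qᵉ` times the product of its creation and its annihilation
factor. -/
theorem expField_eq (hD : IsFock D c) (ε n : ℤ) :
    D.expField ε n = D.q ε * normalOrder (creationExp (creationExponent D.δ ε))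
      (annihilationExp (annihilationExponent D.δ ε)) n := by
  have hLF := ((isField_creationExp (creationExponent D.δ ε)).locallyFinite_normalTerm
    (hD.isField_annihilationExp ε) n).mul_left (D.q ε)
  rw [normalOrder_eq, mul_lfSum _ ((isField_creationExp _).locallyFinite_normalTerm
    (hD.isField_annihilationExp ε) n)]
  set G : ℤ → Module.End ℂ M := fun j => D.q ε * normalTerm (creationExp (creationExponent D.δ ε))
    (annihilationExp (annihilationExponent D.δ ε)) n j with hG
  have hinj : Injective fun l : ℕ => -(l : ℤ) - 1 := fun i j h => by simpa using h
  have hterm : ∀ l r : ℕ, (l : ℤ) - r = -n - 1 → G (-(l : ℤ) - 1) =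
      D.q ε * expCoeff (creationExponent D.δ ε) l * expCoeff (annihilationExponent D.δ ε) r := by
    intro l r h
    simp only [hG]
    rw [normalTerm, if_pos (by omega), creationExp, if_pos (by omega), annihilationExp, if_pos (by omega),
      mul_assoc]
    congr 4 <;> omega
  have hterm' : ∀ l : ℕ, (∀ r : ℕ, (l : ℤ) - r ≠ -n - 1) → G (-(l : ℤ) - 1) = 0 := by
    intro l h
    have : ¬ -1 ≤ n - (-(l : ℤ) - 1) - 1 := fun h' => h (l + n + 1).toNat (by omega)
    simp only [hG]
    rw [normalTerm, if_pos (by omega), annihilationExp, if_neg this, mul_zero, mul_zero]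
  have hF : LocallyFinite fun p : ℕ × ℕ => if (p.1 : ℤ) - (p.2 : ℤ) = -n - 1 then
      D.q ε * expCoeff (creationExponent D.δ ε) p.1 * expCoeff (annihilationExponent D.δ ε) p.2
        else 0 := by
    refine LocallyFinite.of_fibers (fun v => ?_) fun l v => ?_
    · refine ((hLF v).preimage (hinj.injOn)).subset ?_
      rintro l ⟨r, hr⟩
      by_cases h : (l : ℤ) - r = -n - 1
      · rw [if_pos h, ← hterm l r h] at hr
        exact hr
      · exact absurd (by simp [h]) hr
    · refine (Set.finite_singleton (l + n + 1).toNat).subset fun r hr => ?_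
      by_contra hc
      refine hr ?_
      rw [Set.mem_singleton_iff] at hc
      simp [show ¬ (l : ℤ) - r = -n - 1 by omega]
  rw [← lfSum_comp_injective hLF hinj]
  · refine (lfSum_curry hF).trans ?_
    congr 1
    ext1 l
    by_cases h : ∃ r : ℕ, (l : ℤ) - r = -n - 1
    · obtain ⟨r, hr⟩ := h
      rw [lfSum_eq_single r]
      · rw [if_pos hr]
        exact (hterm l r hr).symm
      · intro r' h'
        exact if_neg (by dsimp only; omega)
    · push Not at h
      rw [lfSum_eq_single 0]
      · rw [if_neg (h 0)]
        exact (hterm' l h).symm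
      · exact fun r _ => if_neg (h r)
  · intro j hj
    have : ¬ j < 0 := fun h => hj ⟨(-j - 1).toNat, by dsimp only; omega⟩
    simp [hG, normalTerm, creationExp, this]

theorem isField_expField (hD : IsFock D c) (ε : ℤ) : IsField (D.expField ε) := by
  rw [show D.expField ε = _ from funext (hD.expField_eq ε)]
  exact ((isField_creationExp _).normalOrder (hD.isField_annihilationExp ε)).mul_left _

theorem bracket_expField (hD : IsFock D c) (h : HeisenbergPair a D.δ κ) (hq : Charged D a κ)
    (ε m n : ℤ) : ⁅a m, D.expField ε n⁆ = ((ε : ℂ) * κ) • D.expField ε (n + m) := by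
  have hP := isField_creationExp (creationExponent D.δ ε)
  have hQ := hD.isField_annihilationExp ε
  rw [hD.expField_eq, hD.expField_eq, bracket_mul, hq]
  rcases lt_trichotomy m 0 with hm | rfl | hm
  · rw [if_neg hm.ne, zero_mul, zero_add,
      normalOrder_bracket (a m) hP hQ IsField.zero ((hQ.shift m).smul ((ε : ℂ) * κ))
        (fun j => by rw [h.bracket_creationExp, if_neg (by omega)]; rfl)
        (fun j => by rw [h.bracket_annihilationExp, if_pos hm]; rfl),
      normalOrder_zero_left, zero_add, normalOrder_smul_right _ hP (hQ.shift m), normalOrder_shift_right,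
      mul_smul_comm]
  · rw [if_pos rfl, normalOrder_bracket (a 0) hP hQ IsField.zero IsField.zero
        (fun j => by rw [h.bracket_creationExp, if_neg (by omega)]; rfl)
        (fun j => by rw [h.bracket_annihilationExp, if_neg (by omega)]; rfl),
      normalOrder_zero_left, normalOrder_zero_right, add_zero, mul_zero, add_zero, add_zero,
      smul_mul_assoc]
  · rw [if_neg hm.ne', zero_mul, zero_add,
      normalOrder_bracket (a m) hP hQ ((hP.shift m).smul ((ε : ℂ) * κ)) IsField.zero
        (fun j => by rw [h.bracket_creationExp, if_pos hm]; rfl)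
        (fun j => by rw [h.bracket_annihilationExp, if_neg (by omega)]; rfl),
      normalOrder_zero_right, add_zero, normalOrder_smul_left _ (hP.shift m) hQ,
      normalOrder_shift_left_of_commute hP hQ (hD.commute_creationExp_annihilationExp ε ε),
      mul_smul_comm]

theorem commute_δ_expField (hD : IsFock D c) (ε i j : ℤ) : Commute (D.δ i) (D.expField ε j) := by
  have := hD.bracket_expField hD.δδ hD.charged_δ ε i j
  rw [mul_zero, zero_smul] at this
  exact sub_eq_zero.1 this

theorem commute_q_expField (hD : IsFock D c) (η ε j : ℤ) : Commute (D.q η) (D.expField ε j) := by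
  rw [hD.expField_eq]
  exact (hD.commute_q η ε).mul_right (commute_normalOrder (isField_creationExp _)
    (hD.isField_annihilationExp ε) (commute_creationExp (hD.commute_q_δ η) ε)
    (commute_annihilationExp (hD.commute_q_δ η) ε) j)

theorem commute_expField (hD : IsFock D c) (ε η i j : ℤ) :
    Commute (D.expField ε i) (D.expField η j) := by
  rw [hD.expField_eq η]
  have h := fun l => (hD.commute_δ_expField ε l i).symm
  exact (hD.commute_q_expField η ε i).symm.mul_right (commute_normalOrder (isField_creationExp _)
    (hD.isField_annihilationExp η) (commute_creationExp h η) (commute_annihilationExp h η) j)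

theorem commute_creationPart {X : Module.End ℂ M} (h : ∀ i, Commute X (d i)) (i : ℤ) :
    Commute X (creationPart d i) := by
  rw [creationPart]
  split_ifs
  · exact h i
  · exact Commute.zero_right _

theorem commute_annihilationPart {X : Module.End ℂ M} (h : ∀ i, Commute X (d i)) (i : ℤ) :
    Commute X (annihilationPart d i) := by
  rw [annihilationPart]
  split_ifs
  · exact Commute.zero_right _
  · exact h i

/-- The derivative of the vertex operator: `∂e^{εδ}(z) = ε :δ(z) e^{εδ}(z):`. -/
theorem derivField_expField (hD : IsFock D c) (ε n : ℤ) :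
    derivField (D.expField ε) n = (ε : ℂ) • normalOrder D.δ (D.expField ε) n := by
  set P := creationExp (creationExponent D.δ ε) with hPdef
  set Q := annihilationExp (annihilationExponent D.δ ε) with hQdef
  have hP : IsField P := isField_creationExp _
  have hQ : IsField Q := hD.isField_annihilationExp ε
  have hPQ : ∀ i j, Commute (P i) (Q j) := hD.commute_creationExp_annihilationExp ε ε
  have hδP : ∀ i j, Commute (D.δ i) (P j) := fun i => commute_creationExp (hD.commute_δ i) ε
  have hδQ : ∀ i j, Commute (D.δ i) (Q j) := fun i => commute_annihilationExp (hD.commute_δ i) ε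
  have hc := isField_creationPart D.δ
  have ha := hD.isField_δ.annihilationPart
  have e : D.expField ε = fun n => D.q ε * normalOrder P Q n := funext (hD.expField_eq ε)
  have hdP : derivField P = (ε : ℂ) • normalOrder (creationPart D.δ) P :=
    funext (derivField_creationExp hD.commute_δ ε)
  have hdQ : derivField Q = (ε : ℂ) • normalOrder (annihilationPart D.δ) Q :=
    funext (derivField_annihilationExp hD.commute_δ hD.δ_zero ε)
  have h1 : normalOrder (derivField P) Q n =
      (ε : ℂ) • normalOrder (creationPart D.δ) (normalOrder P Q) n := by
    rw [hdP, normalOrder_smul_left _ (hc.normalOrder hP) hQ, normalOrder_assoc hc hP hQ (κ := 0) hPQ,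
      zero_smul, add_zero]
    exact fun i j => by
      rw [zero_smul, (commute_creationPart (fun l => (hδQ l j).symm) i).symm.lie_eq]
  have h2 : normalOrder P (derivField Q) n =
      (ε : ℂ) • normalOrder (annihilationPart D.δ) (normalOrder P Q) n := by
    have hcomm : ∀ i j, Commute (P i) (derivField Q j) := fun i j => (hPQ _ _).smul_right _
    rw [normalOrder_comm hP hQ.deriv hcomm, hdQ, normalOrder_smul_left _ (ha.normalOrder hQ) hP,
      normalOrder_assoc ha hQ hP (κ := 0) (fun i j => (hPQ j i).symm), zero_smul, add_zero,
      funext (normalOrder_comm hQ hP fun i j => (hPQ j i).symm)]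
    exact fun i j => by
      rw [zero_smul, (commute_annihilationPart (fun l => (hδP l j).symm) i).symm.lie_eq]
  have h3 : derivField (fun n => D.q ε * normalOrder P Q n) n =
      D.q ε * derivField (normalOrder P Q) n := by
    simp only [derivField, mul_smul_comm]
  rw [e, h3, derivField_normalOrder hP hQ, h1, h2, ← smul_add,
    normalOrder_mul_right _ hD.isField_δ (hP.normalOrder hQ) (hD.commute_q_δ ε), mul_smul_comm]
  conv_rhs => rw [← creationPart_add_annihilationPart D.δ]
  rw [normalOrder_add_left hc ha (hP.normalOrder hQ)]

end IsFock

theorem normalOrder_apply_eq_zero (ha : IsField a) (hb : IsField b) {v : M}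
    (hav : ∀ n ≥ 0, a n v = 0) (hbv : ∀ n ≥ 0, b n v = 0) (n : ℤ) (hn : 0 ≤ n) :
    normalOrder a b n v = 0 := by
  rw [normalOrder_eq, lfSum_apply (ha.locallyFinite_normalTerm hb n)]
  refine (finsum_congr fun j => ?_).trans finsum_zero
  rw [normalTerm]
  split_ifs
  · rw [Module.End.mul_apply, hbv _ (by omega), map_zero]
  · rw [Module.End.mul_apply, hav _ (by omega), map_zero]

namespace IsFock

theorem expField_vac (hD : IsFock D c) (ε n : ℤ) (hn : 0 ≤ n) : D.expField ε n D.vac = 0 := by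
  rw [hD.expField_eq, Module.End.mul_apply, normalOrder_apply_eq_zero (isField_creationExp _)
    (hD.isField_annihilationExp ε) (fun n hn => by simp [creationExp, not_lt.2 hn])
    (annihilationExp_apply_eq_zero hD.commute_δ hD.δ_vac ε) n hn, map_zero]

theorem expField_neg_one_vac (hD : IsFock D c) (ε : ℤ) : D.expField ε (-1) D.vac = D.q ε D.vac := by
  have hLF := (isField_creationExp (creationExponent D.δ ε)).locallyFinite_normalTerm
    (hD.isField_annihilationExp ε) (-1)
  rw [hD.expField_eq, Module.End.mul_apply, normalOrder_eq, lfSum_apply hLF, finsum_eq_single _ (-1)]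
  · simp [normalTerm, creationExp, annihilationExp, expCoeff_zero]
  · intro j hj
    rw [normalTerm]
    split_ifs with h
    · rw [Module.End.mul_apply, annihilationExp_apply_eq_zero hD.commute_δ hD.δ_vac ε _ (by omega),
        map_zero]
    · simp [creationExp, h]

/-- The vertex operators of opposite charge are inverse to each other: `e^{εδ}(z) e^{-εδ}(z) = 1`.
The derivative of the product vanishes, which leaves its constant term; this commutes with all
generators and fixes the vacuum. -/
theorem normalOrder_expField_neg (hD : IsFock D c) (ε : ℤ) :
    normalOrder (D.expField ε) (D.expField (-ε)) = monoField 1 (-1) := by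
  have hE := hD.isField_expField ε
  have hF := hD.isField_expField (-ε)
  have hδ := hD.isField_δ
  have hcomm := hD.commute_expField ε (-ε)
  have hderiv : ∀ n, derivField (normalOrder (D.expField ε) (D.expField (-ε))) n = 0 := by
    intro n
    rw [derivField_normalOrder hE hF, normalOrder_comm hE hF.deriv fun i j => (hcomm _ _).smul_right _,
      show derivField (D.expField ε) = _ from funext (hD.derivField_expField ε),
      show derivField (D.expField (-ε)) = _ from funext (hD.derivField_expField (-ε)),
      show (fun n => (ε : ℂ) • normalOrder D.δ (D.expField ε) n) =
        (ε : ℂ) • normalOrder D.δ (D.expField ε) from rfl,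
      show (fun n => ((-ε : ℤ) : ℂ) • normalOrder D.δ (D.expField (-ε)) n) =
        ((-ε : ℤ) : ℂ) • normalOrder D.δ (D.expField (-ε)) from rfl,
      normalOrder_smul_left _ (hδ.normalOrder hE) hF, normalOrder_smul_left _ (hδ.normalOrder hF) hE,
      normalOrder_assoc hδ hE hF (κ := 0) hcomm, normalOrder_assoc hδ hF hE (κ := 0)
        (fun i j => (hcomm j i).symm), funext (normalOrder_comm hE hF hcomm)]
    · push_cast
      module
    · exact fun i j => by rw [zero_smul, (hD.commute_δ_expField _ _ _).lie_eq]
    · exact fun i j => by rw [zero_smul, (hD.commute_δ_expField _ _ _).lie_eq]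
  have hbr : ∀ {a : ℤ → Module.End ℂ M} {κ : ℂ}, HeisenbergPair a D.δ κ → Charged D a κ → ∀ m n,
      Commute (a m) (normalOrder (D.expField ε) (D.expField (-ε)) n) := by
    intro a κ h hq m n
    refine sub_eq_zero.1 ?_
    rw [← Ring.lie_def, normalOrder_bracket (a m) hE hF ((hE.shift m).smul ((ε : ℂ) * κ))
      ((hF.shift m).smul (((-ε : ℤ) : ℂ) * κ)) (fun j => hD.bracket_expField h hq ε m j)
      (fun j => hD.bracket_expField h hq (-ε) m j), normalOrder_smul_left _ (hE.shift m) hF,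
      normalOrder_smul_right _ hE (hF.shift m), normalOrder_shift_right,
      normalOrder_shift_left_of_commute hE hF hcomm]
    push_cast
    module
  have hvac : normalOrder (D.expField ε) (D.expField (-ε)) (-1) D.vac = D.vac := by
    rw [normalOrder_eq, lfSum_apply (hE.locallyFinite_normalTerm hF _), finsum_eq_single _ (-1)]
    · rw [normalTerm, if_pos (by omega), Module.End.mul_apply, show (-1 : ℤ) - -1 - 1 = -1 by ring,
        expField_neg_one_vac hD, ← Module.End.mul_apply, ← (hD.commute_q_expField _ _ _).eq,
        Module.End.mul_apply, expField_neg_one_vac hD, ← Module.End.mul_apply, ← hD.q_add, neg_add_cancel,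
        hD.q_zero, Module.End.one_apply]
    · intro j hj
      rw [normalTerm]
      split_ifs with h
      · rw [Module.End.mul_apply, hD.expField_vac _ _ (by omega), map_zero]
      · rw [Module.End.mul_apply, hD.expField_vac _ _ (by omega), map_zero]
  have hone : normalOrder (D.expField ε) (D.expField (-ε)) (-1) = 1 := by
    set G := normalOrder (D.expField ε) (D.expField (-ε)) (-1) with hG
    have step : ∀ X, Commute X G → ∀ w ∈ LinearMap.ker (G - 1), X w ∈ LinearMap.ker (G - 1) := by
      intro X hX w hw
      rw [LinearMap.mem_ker, LinearMap.sub_apply, Module.End.one_apply, sub_eq_zero] at hw ⊢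
      rw [← Module.End.mul_apply, ← hX.eq, Module.End.mul_apply, hw]
    ext v
    have := hD.cyclic (LinearMap.ker (G - 1)) (by
        rw [LinearMap.mem_ker, LinearMap.sub_apply, Module.End.one_apply, hvac, sub_self])
      (fun n _ => step _ (hbr hD.αδ hD.charged_α n _)) (fun n _ => step _ (hbr hD.γδ hD.charged_γ n _))
      (fun n _ => step _ (hbr hD.δδ hD.charged_δ n _))
      (fun η => step _ (commute_normalOrder hE hF (hD.commute_q_expField η ε)
        (hD.commute_q_expField η (-ε)) _)) v
    rwa [LinearMap.mem_ker, LinearMap.sub_apply, sub_eq_zero] at this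
  ext1 n
  rw [monoField]
  split_ifs with h
  · rw [h, hone, one_smul]
  · have := hderiv (n + 1)
    rw [derivField, add_sub_cancel_right, smul_eq_zero_iff_right] at this
    · exact this
    · rw [Ne, neg_eq_zero, Int.cast_eq_zero]
      omega

end IsFock

end FockSpace

section Currents

variable {M : Type*} [AddCommGroup M] [Module ℂ M] {a b x y : ℤ → Module.End ℂ M} {D : FockModes M}
  {c k κ κa κb κx κy : ℂ}

/-! ### The current algebra -/

theorem HeisenbergPair.add_left (h : HeisenbergPair a y κa) (h' : HeisenbergPair b y κb) :
    HeisenbergPair (a + b) y (κa + κb) := by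
  intro m n
  rw [Pi.add_apply, add_bracket, h, h']
  split_ifs
  · module
  · simp

theorem HeisenbergPair.smul_left (r : ℂ) (h : HeisenbergPair a y κa) :
    HeisenbergPair (r • a) y (r * κa) := by
  intro m n
  rw [Pi.smul_apply, smul_bracket, h]
  split_ifs
  · module
  · simp

theorem HeisenbergPair.sub_left (h : HeisenbergPair a y κa) (h' : HeisenbergPair b y κb) :
    HeisenbergPair (a - b) y (κa - κb) := by
  have := h.add_left (h'.smul_left (-1))
  rwa [neg_one_smul, ← sub_eq_add_neg, neg_one_mul, ← sub_eq_add_neg] at this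

theorem HeisenbergPair.add_right (h : HeisenbergPair a x κx) (h' : HeisenbergPair a y κy) :
    HeisenbergPair a (x + y) (κx + κy) := (h.symm.add_left h'.symm).symm

theorem HeisenbergPair.sub_right (h : HeisenbergPair a x κx) (h' : HeisenbergPair a y κy) :
    HeisenbergPair a (x - y) (κx - κy) := (h.symm.sub_left h'.symm).symm

theorem HeisenbergPair.bracket_eq_monoField (h : HeisenbergPair a b κ) (m n : ℤ) :
    ⁅a m, b n⁆ = monoField ((m : ℂ) * κ) (-m) n := by
  rw [h, monoField]
  by_cases h0 : m + n = 0
  · rw [if_pos h0, if_pos (by omega)]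
  · rw [if_neg h0, if_neg (by omega)]

theorem HeisenbergPair.bracket_normalOrder (hx : HeisenbergPair a x κx) (hy : HeisenbergPair a y κy)
    (hfx : IsField x) (hfy : IsField y) (p n : ℤ) :
    ⁅a p, normalOrder x y n⁆ =
      ((p : ℂ) * κx) • y (n + p - 1) + ((p : ℂ) * κy) • x (n + p - 1) := by
  rw [normalOrder_bracket (a p) hfx hfy (.mono _ _) (.mono _ _) (hx.bracket_eq_monoField p)
    (hy.bracket_eq_monoField p), normalOrder_mono_left, normalOrder_mono_right, sub_neg_eq_add]

namespace IsFock

theorem bracket_vertex (hD : IsFock D c) (hab : HeisenbergPair a b κ) (ha : HeisenbergPair a D.δ κa)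
    (hqa : Charged D a κa) (hfb : IsField b) (η p n : ℤ) :
    ⁅a p, normalOrder b (D.expField η) n⁆ = ((p : ℂ) * κ) • D.expField η (n + p - 1) +
      ((η : ℂ) * κa) • normalOrder b (D.expField η) (n + p) := by
  have hE := hD.isField_expField η
  rw [normalOrder_bracket (a p) hfb hE (.mono _ _) ((hE.shift p).smul ((η : ℂ) * κa))
    (hab.bracket_eq_monoField p) (fun j => hD.bracket_expField ha hqa η p j), normalOrder_mono_left,
    normalOrder_smul_right _ hfb (hE.shift p), normalOrder_shift_right, sub_neg_eq_add]

theorem vertex_bracket_expField (hD : IsFock D c) (hb : HeisenbergPair b D.δ κb)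
    (hqb : Charged D b κb) (hfb : IsField b) (η ε n j : ℤ) :
    ⁅normalOrder b (D.expField η) n, D.expField ε j⁆ =
      ((ε : ℂ) * κb) • normalOrder (D.expField η) (D.expField ε) (n + j) := by
  have hE := hD.isField_expField η
  have hF := hD.isField_expField ε
  rw [← bracket_skew, normalOrder_bracket (D.expField ε j) hfb hE
    ((hF.shift j).smul (-((ε : ℂ) * κb))) .zero (fun i => ?_)
    (fun i => (hD.commute_expField ε η j i).lie_eq), normalOrder_zero_right, add_zero,
    normalOrder_smul_left _ (hF.shift j) hE,
    normalOrder_shift_left_of_commute hF hE (hD.commute_expField ε η),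
    normalOrder_comm hF hE (hD.commute_expField ε η), neg_smul, neg_neg]
  rw [← bracket_skew, hD.bracket_expField hb hqb, add_comm, Pi.smul_apply, neg_smul]
  rfl

/-- The commutator of two fields `:b(z) e^{ηδ}(z):` and `:a(z) e^{εδ}(z):`. The first summand collects
the contraction of `b` with `a` and the double contraction of each with the exponential of the other;
the last two summands are the single contractions. For `e` with `e` and for `f` with `f`, everything
cancels. -/
theorem vertex_bracket_vertex (hD : IsFock D c) (hab : HeisenbergPair a b κ)
    (ha : HeisenbergPair a D.δ κa) (hb : HeisenbergPair b D.δ κb) (hqa : Charged D a κa)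
    (hqb : Charged D b κb) (hfa : IsField a) (hfb : IsField b) (η ε n m : ℤ) :
    ⁅normalOrder b (D.expField η) n, normalOrder a (D.expField ε) m⁆ =
      (κ - (η : ℂ) * κa * ((ε : ℂ) * κb)) •
        (normalOrder (derivField (D.expField η)) (D.expField ε) (m + n) +
          (n : ℂ) • normalOrder (D.expField η) (D.expField ε) (m + n - 1))
      - ((η : ℂ) * κa) • normalOrder b (normalOrder (D.expField η) (D.expField ε)) (m + n)
      + ((ε : ℂ) * κb) • normalOrder a (normalOrder (D.expField η) (D.expField ε)) (m + n) := by
  have hE := hD.isField_expField η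
  have hF := hD.isField_expField ε
  have hV := hfb.normalOrder hE
  have hEF := hD.commute_expField η ε
  have hdEF : ∀ i j, Commute (derivField (D.expField η) i) (D.expField ε j) := fun i j =>
    (hEF _ _).smul_left _
  rw [normalOrder_bracket (normalOrder b (D.expField η) n) hfa hF
    (a' := κ • (shiftField (derivField (D.expField η)) n +
      (n : ℂ) • shiftField (D.expField η) (n - 1)) -
        ((η : ℂ) * κa) • shiftField (normalOrder b (D.expField η)) n)
    (b' := ((ε : ℂ) * κb) • shiftField (normalOrder (D.expField η) (D.expField ε)) n)
    ((((hE.deriv.shift n).add ((hE.shift _).smul _)).smul _).sub ((hV.shift n).smul _))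
    (((hE.normalOrder hF).shift n).smul _) (fun j => ?_) (fun j => ?_),
    sub_eq_add_neg (κ • _) (((η : ℂ) * κa) • shiftField _ _), ← neg_smul,
    normalOrder_add_left (((hE.deriv.shift n).add ((hE.shift _).smul _)).smul _)
      ((hV.shift n).smul _) hF,
    normalOrder_smul_left _ ((hE.deriv.shift n).add ((hE.shift _).smul _)) hF,
    normalOrder_add_left (hE.deriv.shift n) ((hE.shift _).smul _) hF,
    normalOrder_smul_left _ (hE.shift _) hF, normalOrder_smul_left _ (hV.shift n) hF,
    normalOrder_shift_left_of_commute hE.deriv hF hdEF, normalOrder_shift_left_of_commute hE hF hEF,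
    normalOrder_shift_left hV hF (K := ((ε : ℂ) * κb) •
      normalOrder (D.expField η) (D.expField ε) (m + n - 1)) n m (fun i => ?_),
    normalOrder_smul_right _ hfa ((hE.normalOrder hF).shift n), normalOrder_shift_right,
    normalOrder_assoc hfb hE hF (κ := (ε : ℂ) * κb) hEF
      (fun i j => by rw [hD.bracket_expField hb hqb, add_comm]), add_sub_assoc]
  · module
  · rw [hD.vertex_bracket_expField hb hqb hfb]
    congr 2
    ring
  · rw [← bracket_skew, hD.bracket_vertex hab ha hqa hfb]
    simp only [Pi.sub_apply, Pi.smul_apply, Pi.add_apply, shiftField, derivField]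
    rw [show j + n - 1 = n + j - 1 by ring, show j + (n - 1) = n + j - 1 by ring, add_comm j n]
    push_cast
    module
  · rw [hD.vertex_bracket_expField hb hqb hfb, add_comm]
    rfl

theorem isField_e (hD : IsFock D c) : IsField D.e := hD.isField_α.normalOrder (hD.isField_expField 1)

theorem isField_f (hD : IsFock D c) : IsField D.f :=
  hD.isField_γ.normalOrder (hD.isField_expField (-1))

theorem h_eq (D : FockModes M) (k : ℂ) : D.h k = k • D.δ + D.α - D.γ := rfl

theorem isField_h (hD : IsFock D c) (k : ℂ) : IsField (D.h k) :=
  ((hD.isField_δ.smul k).add hD.isField_α).sub hD.isField_γ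

theorem bracket_e_e (hD : IsFock D c) (m n : ℤ) : ⁅D.e m, D.e n⁆ = 0 := by
  rw [FockModes.e, hD.vertex_bracket_vertex hD.αα hD.αδ hD.αδ hD.charged_α hD.charged_α hD.isField_α
    hD.isField_α]
  push_cast
  module

theorem bracket_f_f (hD : IsFock D c) (m n : ℤ) : ⁅D.f m, D.f n⁆ = 0 := by
  rw [FockModes.f, hD.vertex_bracket_vertex hD.γγ hD.γδ hD.γδ hD.charged_γ hD.charged_γ hD.isField_γ
    hD.isField_γ]
  push_cast
  module

theorem bracket_f_e (hD : IsFock D (k + 1)) (m n : ℤ) :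
    ⁅D.f m, D.e n⁆ = (-shiftField (D.h k) m + monoField ((m : ℂ) * k) (-m) : ℤ → Module.End ℂ M) n := by
  have hE := hD.isField_expField (-1)
  have hF := hD.isField_expField 1
  have hone : normalOrder (D.expField (-1)) (D.expField 1) = monoField 1 (-1) := by
    simpa using hD.normalOrder_expField_neg (-1)
  have hder : normalOrder (derivField (D.expField (-1))) (D.expField 1) (n + m) = -D.δ (n + m) := by
    rw [show derivField (D.expField (-1)) = (((-1 : ℤ) : ℂ)) • normalOrder D.δ (D.expField (-1)) from
      funext (hD.derivField_expField (-1)), normalOrder_smul_left _ (hD.isField_δ.normalOrder hE) hF,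
      normalOrder_assoc hD.isField_δ hE hF (κ := 0) (hD.commute_expField _ _)
      (fun i j => by rw [zero_smul, (hD.commute_δ_expField _ _ _).lie_eq]), hone,
      normalOrder_mono_right]
    simp
  rw [FockModes.e, FockModes.f, hD.vertex_bracket_vertex hD.αγ hD.αδ hD.γδ hD.charged_α hD.charged_γ
    hD.isField_α hD.isField_γ, hder, hone, normalOrder_mono_right, normalOrder_mono_right]
  simp only [Pi.add_apply, Pi.neg_apply, shiftField, monoField, FockModes.h, sub_neg_eq_add,
    add_sub_cancel_right]
  by_cases h0 : n + m = 0
  · rw [if_pos (by omega), if_pos (by omega)]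
    push_cast
    module
  · rw [if_neg (by omega), if_neg (by omega)]
    push_cast
    module

theorem bracket_e_f (hD : IsFock D (k + 1)) (m n : ℤ) :
    ⁅D.e m, D.f n⁆ =
      (shiftField (D.h k) m + monoField ((m : ℂ) * k) (-m) : ℤ → Module.End ℂ M) n := by
  rw [← bracket_skew, hD.bracket_f_e]
  simp only [Pi.add_apply, Pi.neg_apply, shiftField, monoField, add_comm m n]
  by_cases h0 : m + n = 0
  · obtain rfl : n = -m := by omega
    rw [if_pos (by omega), if_pos (by omega)]
    push_cast
    module
  · rw [if_neg (by omega), if_neg (by omega)]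
    module

theorem bracket_h_e (hD : IsFock D (k + 1)) (m n : ℤ) :
    ⁅D.h k m, D.e n⁆ = ((2 : ℂ) • shiftField D.e m) n := by
  have e1 := hD.bracket_vertex hD.αδ.symm hD.δδ hD.charged_δ hD.isField_α 1 m n
  have e2 := hD.bracket_vertex hD.αα hD.αδ hD.charged_α hD.isField_α 1 m n
  have e3 := hD.bracket_vertex hD.αγ.symm hD.γδ hD.charged_γ hD.isField_α 1 m n
  rw [FockModes.h, sub_bracket, add_bracket, smul_bracket,
    FockModes.e, e1, e2, e3]
  simp only [Pi.smul_apply, shiftField]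
  push_cast
  module

theorem bracket_h_f (hD : IsFock D (k + 1)) (m n : ℤ) :
    ⁅D.h k m, D.f n⁆ = ((-2 : ℂ) • shiftField D.f m) n := by
  have e1 := hD.bracket_vertex hD.γδ.symm hD.δδ hD.charged_δ hD.isField_γ (-1) m n
  have e2 := hD.bracket_vertex hD.αγ hD.αδ hD.charged_α hD.isField_γ (-1) m n
  have e3 := hD.bracket_vertex hD.γγ hD.γδ hD.charged_γ hD.isField_γ (-1) m n
  rw [FockModes.h, sub_bracket, add_bracket, smul_bracket,
    FockModes.f, e1, e2, e3]
  simp only [Pi.smul_apply, shiftField]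
  push_cast
  module

theorem bracket_e_h (hD : IsFock D (k + 1)) (m n : ℤ) :
    ⁅D.e m, D.h k n⁆ = ((-2 : ℂ) • shiftField D.e m) n := by
  rw [← bracket_skew, hD.bracket_h_e]
  simp only [Pi.smul_apply, shiftField, add_comm m n, neg_smul]

theorem bracket_f_h (hD : IsFock D (k + 1)) (m n : ℤ) :
    ⁅D.f m, D.h k n⁆ = ((2 : ℂ) • shiftField D.f m) n := by
  rw [← bracket_skew, hD.bracket_h_f]
  simp only [Pi.smul_apply, shiftField, add_comm m n, neg_smul, neg_neg]

theorem bracket_h_h (hD : IsFock D (k + 1)) (m n : ℤ) :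
    ⁅D.h k m, D.h k n⁆ = monoField ((m : ℂ) * (2 * k)) (-m) n := by
  have hδ := ((hD.δδ.smul_left k).add_left hD.αδ).sub_left hD.γδ
  have hα := ((hD.αδ.symm.smul_left k).add_left hD.αα).sub_left hD.αγ.symm
  have hγ := ((hD.γδ.symm.smul_left k).add_left hD.αγ).sub_left hD.γγ
  have := (((hδ.symm.smul_left k).add_left hα.symm).sub_left hγ.symm).symm.bracket_eq_monoField m n
  rw [h_eq, this]
  congr 2
  ring

/-! ### The translation operator -/

theorem bracket_virasoro (hD : IsFock D (k + 1)) (hα : HeisenbergPair a D.α κa)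
    (hγ : HeisenbergPair a D.γ κb) (hδ : HeisenbergPair a D.δ κ) (p : ℤ) :
    ⁅a p, D.virasoro k 0⁆ = (p : ℂ) •
      ((k / 2 * κ) • D.δ (p - 1) + (1 / 2 * κ) • (D.α - D.γ) (p - 1) + (1 / 2 * (κa - κb)) • D.δ (p - 1)
        + (1 / (2 * (k + 2)) * (κa + κb)) • (D.α + D.γ) (p - 1)) := by
  rw [FockModes.virasoro, bracket_add, bracket_add, bracket_smul, bracket_smul, bracket_smul,
    hδ.bracket_normalOrder hδ hD.isField_δ hD.isField_δ,
    hδ.bracket_normalOrder (hα.sub_right hγ) hD.isField_δ (hD.isField_α.sub hD.isField_γ),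
    (hα.add_right hγ).bracket_normalOrder (hα.add_right hγ) (hD.isField_α.add hD.isField_γ)
      (hD.isField_α.add hD.isField_γ), zero_add]
  rw [show 1 / (4 * (k + 2)) = (1 / (2 * (k + 2))) / 2 by rw [div_div]; ring_nf]
  module

theorem bracket_δ_virasoro (hD : IsFock D (k + 1)) (p : ℤ) :
    ⁅D.δ p, D.virasoro k 0⁆ = (p : ℂ) • D.δ (p - 1) := by
  rw [hD.bracket_virasoro hD.αδ.symm hD.γδ.symm hD.δδ]
  module

/-- At the critical level the coefficient on the left is `0`, but then so is `α + γ`. -/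
theorem smul_α_add_γ (hk : k ≠ -2 ∨ D.α + D.γ = 0) (p : ℤ) :
    (1 / (2 * (k + 2)) * (k + 2)) • (D.α + D.γ) p = (1 / 2 : ℂ) • (D.α p + D.γ p) := by
  rcases hk with hk | hk
  · have : k + 2 ≠ 0 := fun h => hk (eq_neg_of_add_eq_zero_left h)
    rw [Pi.add_apply]
    congr 1
    field_simp
  · rw [← show (D.α + D.γ) p = D.α p + D.γ p from rfl, hk, Pi.zero_apply, smul_zero, smul_zero]

theorem bracket_α_virasoro (hD : IsFock D (k + 1)) (hk : k ≠ -2 ∨ D.α + D.γ = 0) (p : ℤ) :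
    ⁅D.α p, D.virasoro k 0⁆ = (p : ℂ) • D.α (p - 1) := by
  rw [hD.bracket_virasoro hD.αα hD.αγ hD.αδ, show 1 + (k + 1) = k + 2 by ring, smul_α_add_γ hk,
    Pi.sub_apply]
  module

theorem bracket_γ_virasoro (hD : IsFock D (k + 1)) (hk : k ≠ -2 ∨ D.α + D.γ = 0) (p : ℤ) :
    ⁅D.γ p, D.virasoro k 0⁆ = (p : ℂ) • D.γ (p - 1) := by
  rw [hD.bracket_virasoro hD.αγ.symm hD.γγ hD.γδ, show k + 1 + 1 = k + 2 by ring, smul_α_add_γ hk,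
    Pi.sub_apply]
  module

theorem expField_bracket (hD : IsFock D c) (h : HeisenbergPair a D.δ κ) (hq : Charged D a κ)
    (ε n j : ℤ) : ⁅D.expField ε n, a j⁆ = ((-((ε : ℂ) * κ)) • shiftField (D.expField ε) n) j := by
  rw [← bracket_skew, hD.bracket_expField h hq, add_comm, Pi.smul_apply, neg_smul]
  rfl

theorem expField_bracket_normalOrder (hD : IsFock D c) (hx : HeisenbergPair x D.δ κx)
    (hqx : Charged D x κx) (hy : HeisenbergPair y D.δ κy) (hqy : Charged D y κy) (hfx : IsField x)
    (hfy : IsField y) (ε n : ℤ) :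
    ⁅D.expField ε n, normalOrder x y 0⁆ =
      (-((ε : ℂ) * κx)) • normalOrder (shiftField (D.expField ε) n) y 0 +
        (-((ε : ℂ) * κy)) • normalOrder x (D.expField ε) n := by
  have hE := hD.isField_expField ε
  rw [normalOrder_bracket (D.expField ε n) hfx hfy ((hE.shift n).smul _) ((hE.shift n).smul _)
    (hD.expField_bracket hx hqx ε n) (hD.expField_bracket hy hqy ε n),
    normalOrder_smul_left _ (hE.shift n) hfy, normalOrder_smul_right _ hfx (hE.shift n),
    normalOrder_shift_right, zero_add]

theorem charged_add (h : Charged D x κx) (h' : Charged D y κy) : Charged D (x + y) (κx + κy) := by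
  intro m ε
  rw [Pi.add_apply, add_bracket, h, h']
  split_ifs
  · module
  · simp

theorem charged_sub (h : Charged D x κx) (h' : Charged D y κy) : Charged D (x - y) (κx - κy) := by
  intro m ε
  rw [Pi.sub_apply, sub_bracket, h, h']
  split_ifs
  · module
  · simp

/-- Only the summand `½ :δ(α - γ):` of the Virasoro field contributes, because `(δ, δ) = 0` and
`(α + γ, δ) = 0`. -/
theorem virasoro_bracket_expField (hD : IsFock D c) (k : ℂ) (ε n : ℤ) :
    ⁅D.virasoro k 0, D.expField ε n⁆ = derivField (D.expField ε) n := by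
  rw [← bracket_skew, FockModes.virasoro, bracket_add, bracket_add, bracket_smul, bracket_smul,
    bracket_smul, hD.expField_bracket_normalOrder hD.δδ hD.charged_δ hD.δδ hD.charged_δ hD.isField_δ
      hD.isField_δ,
    hD.expField_bracket_normalOrder hD.δδ hD.charged_δ (hD.αδ.sub_left hD.γδ)
      (charged_sub hD.charged_α hD.charged_γ) hD.isField_δ (hD.isField_α.sub hD.isField_γ),
    hD.expField_bracket_normalOrder (hD.αδ.add_left hD.γδ) (charged_add hD.charged_α hD.charged_γ)
      (hD.αδ.add_left hD.γδ) (charged_add hD.charged_α hD.charged_γ)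
      (hD.isField_α.add hD.isField_γ) (hD.isField_α.add hD.isField_γ), hD.derivField_expField]
  module

theorem virasoro_bracket_vertex (hD : IsFock D (k + 1)) (hfa : IsField a)
    (ha : ∀ p : ℤ, ⁅a p, D.virasoro k 0⁆ = (p : ℂ) • a (p - 1)) (ε n : ℤ) :
    ⁅normalOrder a (D.expField ε) n, D.virasoro k 0⁆ =
      (n : ℂ) • normalOrder a (D.expField ε) (n - 1) := by
  have hE := hD.isField_expField ε
  rw [← bracket_skew, normalOrder_bracket (D.virasoro k 0) hfa hE hfa.deriv hE.deriv
    (fun j => by rw [← bracket_skew, ha, derivField, neg_smul])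
    (hD.virasoro_bracket_expField k ε), ← derivField_normalOrder hfa hE, derivField, neg_smul, neg_neg]

theorem bracket_e_virasoro (hD : IsFock D (k + 1)) (hk : k ≠ -2 ∨ D.α + D.γ = 0) (n : ℤ) :
    ⁅D.e n, D.virasoro k 0⁆ = (n : ℂ) • D.e (n - 1) :=
  hD.virasoro_bracket_vertex hD.isField_α (hD.bracket_α_virasoro hk) 1 n

theorem bracket_f_virasoro (hD : IsFock D (k + 1)) (hk : k ≠ -2 ∨ D.α + D.γ = 0) (n : ℤ) :
    ⁅D.f n, D.virasoro k 0⁆ = (n : ℂ) • D.f (n - 1) :=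
  hD.virasoro_bracket_vertex hD.isField_γ (hD.bracket_γ_virasoro hk) (-1) n

theorem bracket_h_virasoro (hD : IsFock D (k + 1)) (hk : k ≠ -2 ∨ D.α + D.γ = 0) (n : ℤ) :
    ⁅D.h k n, D.virasoro k 0⁆ = (n : ℂ) • D.h k (n - 1) := by
  rw [FockModes.h, sub_bracket, add_bracket, smul_bracket,
    hD.bracket_δ_virasoro, hD.bracket_α_virasoro hk,
    hD.bracket_γ_virasoro hk, FockModes.h]
  module

/-! ### The vacuum -/

theorem e_vac (hD : IsFock D c) : ∀ n ≥ 0, D.e n D.vac = 0 :=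
  normalOrder_apply_eq_zero hD.isField_α (hD.isField_expField 1) hD.α_vac (hD.expField_vac 1)

theorem f_vac (hD : IsFock D c) : ∀ n ≥ 0, D.f n D.vac = 0 :=
  normalOrder_apply_eq_zero hD.isField_γ (hD.isField_expField (-1)) hD.γ_vac (hD.expField_vac (-1))

theorem h_vac (hD : IsFock D c) (k : ℂ) : ∀ n ≥ 0, D.h k n D.vac = 0 := fun n hn => by
  simp [FockModes.h, hD.α_vac n hn, hD.γ_vac n hn, hD.δ_vac n hn]

theorem virasoro_vac (hD : IsFock D c) (k : ℂ) : D.virasoro k 0 D.vac = 0 := by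
  have hα := hD.isField_α
  have hγ := hD.isField_γ
  have hsub : ∀ n ≥ 0, (D.α - D.γ) n D.vac = 0 := fun n hn => by simp [hD.α_vac n hn, hD.γ_vac n hn]
  have hadd : ∀ n ≥ 0, (D.α + D.γ) n D.vac = 0 := fun n hn => by simp [hD.α_vac n hn, hD.γ_vac n hn]
  rw [FockModes.virasoro, LinearMap.add_apply, LinearMap.add_apply, LinearMap.smul_apply,
    LinearMap.smul_apply, LinearMap.smul_apply,
    normalOrder_apply_eq_zero hD.isField_δ hD.isField_δ hD.δ_vac hD.δ_vac 0 le_rfl,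
    normalOrder_apply_eq_zero hD.isField_δ (hα.sub hγ) hD.δ_vac hsub 0 le_rfl,
    normalOrder_apply_eq_zero (hα.add hγ) (hα.add hγ) hadd hadd 0 le_rfl]
  simp

end IsFock

end Currents

section Casimir

variable {M : Type*} [AddCommGroup M] [Module ℂ M] {a b a' b' : ℤ → Module.End ℂ M} {D : FockModes M}
  {k : ℂ}

/-! ### Fields on the tensor square -/

/-- The diagonal action of an operator on the tensor square. -/
def diagAction (X : Module.End ℂ M) : Module.End ℂ (M ⊗[ℂ] M) :=
  TensorProduct.map X LinearMap.id + TensorProduct.map LinearMap.id X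

theorem diagAction_bracket_map (X A B : Module.End ℂ M) :
    ⁅diagAction X, TensorProduct.map A B⁆ = TensorProduct.map ⁅X, A⁆ B + TensorProduct.map A ⁅X, B⁆ := by
  ext v w
  simp [diagAction, Ring.lie_def, TensorProduct.sub_tmul, TensorProduct.tmul_sub]
  abel

theorem IsField.locallyFinite_tensorField (ha : IsField a) (hb : IsField b) (n : ℤ) :
    LocallyFinite fun j : ℤ => TensorProduct.map (a j) (b (n - j - 1)) := by
  intro t
  induction t with
  | zero => simp
  | tmul v w =>
    obtain ⟨N, hN⟩ := ha v
    obtain ⟨K, hK⟩ := hb w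
    refine (Set.finite_Ico (n - K) N).subset fun j hj => ?_
    by_contra hc
    apply hj
    simp only [Set.mem_Ico, not_and_or, not_le, not_lt] at hc
    rcases hc with hc | hc
    · simp [hK (n - j - 1) (by omega)]
    · simp [hN j hc]
  | add s t hs ht =>
    refine (hs.union ht).subset fun j hj => ?_
    by_contra hc
    simp only [Set.mem_union, Function.mem_support, not_or, not_not] at hc
    exact hj (by simp [hc.1, hc.2])

theorem diagAction_bracket_tensorField (X : Module.End ℂ M) (ha : IsField a) (hb : IsField b)
    (ha' : IsField a') (hb' : IsField b') (hXa : ∀ j, ⁅X, a j⁆ = a' j) (hXb : ∀ j, ⁅X, b j⁆ = b' j)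
    (n : ℤ) : ⁅diagAction X, tensorField a b n⁆ = tensorField a' b n + tensorField a b' n := by
  simp only [tensorField]
  rw [bracket_lfSum _ (ha.locallyFinite_tensorField hb n),
    ← lfSum_add (ha'.locallyFinite_tensorField hb n) (ha.locallyFinite_tensorField hb' n)]
  simp only [diagAction_bracket_map, hXa, hXb]

theorem tensorField_add_left (ha : IsField a) (ha' : IsField a') (hb : IsField b) (n : ℤ) :
    tensorField (a + a') b n = tensorField a b n + tensorField a' b n := by
  simp only [tensorField, Pi.add_apply, TensorProduct.map_add_left]
  exact lfSum_add (ha.locallyFinite_tensorField hb n) (ha'.locallyFinite_tensorField hb n)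

theorem tensorField_add_right (ha : IsField a) (hb : IsField b) (hb' : IsField b') (n : ℤ) :
    tensorField a (b + b') n = tensorField a b n + tensorField a b' n := by
  simp only [tensorField, Pi.add_apply, TensorProduct.map_add_right]
  exact lfSum_add (ha.locallyFinite_tensorField hb n) (ha.locallyFinite_tensorField hb' n)

theorem tensorField_smul_left (r : ℂ) (ha : IsField a) (hb : IsField b) (n : ℤ) :
    tensorField (r • a) b n = r • tensorField a b n := by
  simp only [tensorField, Pi.smul_apply, TensorProduct.map_smul_left]
  exact (smul_lfSum r (ha.locallyFinite_tensorField hb n)).symm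

theorem tensorField_smul_right (r : ℂ) (ha : IsField a) (hb : IsField b) (n : ℤ) :
    tensorField a (r • b) n = r • tensorField a b n := by
  simp only [tensorField, Pi.smul_apply, TensorProduct.map_smul_right]
  exact (smul_lfSum r (ha.locallyFinite_tensorField hb n)).symm

theorem tensorField_zero_left (n : ℤ) : tensorField 0 b n = 0 := by
  simp only [tensorField]
  rw [lfSum_eq_single 0] <;> simp

theorem tensorField_zero_right (n : ℤ) : tensorField a 0 n = 0 := by
  simp only [tensorField]
  rw [lfSum_eq_single 0] <;> simp

theorem tensorField_mono_left (r : ℂ) (m n : ℤ) :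
    tensorField (monoField r m) b n = r • TensorProduct.map 1 (b (n - m - 1)) := by
  simp only [tensorField]
  rw [lfSum_eq_single m]
  · simp [monoField, TensorProduct.map_smul_left]
  · intro i hi
    simp [monoField, hi]

theorem tensorField_mono_right (r : ℂ) (m n : ℤ) :
    tensorField a (monoField r m) n = r • TensorProduct.map (a (n - m - 1)) 1 := by
  simp only [tensorField]
  rw [lfSum_eq_single (n - m - 1)]
  · simp [monoField, TensorProduct.map_smul_right, show n - (n - m - 1) - 1 = m by ring]
  · intro i hi
    simp [monoField, show n - i - 1 ≠ m by omega]

theorem tensorField_shift_right (m n : ℤ) :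
    tensorField a (shiftField b m) n = tensorField a b (n + m) := by
  simp only [tensorField, shiftField, show ∀ j, n - j - 1 + m = n + m - j - 1 from fun j => by ring]

theorem tensorField_shift_left (ha : IsField a) (hb : IsField b) (m n : ℤ) :
    tensorField (shiftField a m) b n = tensorField a b (n + m) := by
  simp only [tensorField]
  rw [← lfSum_comp_equiv (Equiv.addRight m) (ha.locallyFinite_tensorField hb (n + m))]
  simp only [Equiv.coe_addRight, shiftField,
    show ∀ j, n + m - (j + m) - 1 = n - j - 1 from fun j => by ring]

theorem tensorField_vac {v : M} (ha : IsField a) (hb : IsField b) (hav : ∀ n ≥ 0, a n v = 0)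
    (hbv : ∀ n ≥ 0, b n v = 0) : tensorField a b 0 (v ⊗ₜ[ℂ] v) = 0 := by
  rw [tensorField, lfSum_apply (ha.locallyFinite_tensorField hb 0)]
  refine (finsum_congr fun j => ?_).trans finsum_zero
  rw [TensorProduct.map_tmul]
  rcases le_or_gt 0 j with hj | hj
  · rw [hav j hj, TensorProduct.zero_tmul]
  · rw [hbv _ (by omega), TensorProduct.tmul_zero]

/-! ### The Casimir operator -/

namespace IsFock

theorem casimir_vac (hD : IsFock D (k + 1)) : D.casimir k 0 (D.vac ⊗ₜ[ℂ] D.vac) = 0 := by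
  simp only [FockModes.casimir, LinearMap.sub_apply, LinearMap.add_apply, LinearMap.smul_apply,
    tensorField_vac hD.isField_e hD.isField_f hD.e_vac hD.f_vac,
    tensorField_vac hD.isField_f hD.isField_e hD.f_vac hD.e_vac,
    tensorField_vac (hD.isField_h k) (hD.isField_h k) (hD.h_vac k) (hD.h_vac k),
    TensorProduct.map_tmul, hD.virasoro_vac k, TensorProduct.tmul_zero, TensorProduct.zero_tmul]
  simp

/-- If `[X, L₋₁] = m Y`, the bracket of the diagonal action of `X` with `k ⊗ L₋₁ + L₋₁ ⊗ k` is
`m k (1 ⊗ Y + Y ⊗ 1)`, the value of the central term produced by the Casimir tensor. -/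
theorem diagAction_bracket_translation {X Y : Module.End ℂ M} {m : ℤ}
    (hX : ⁅X, D.virasoro k 0⁆ = (m : ℂ) • Y) :
    ⁅diagAction X, TensorProduct.map (k • LinearMap.id) (D.virasoro k 0) +
      TensorProduct.map (D.virasoro k 0) (k • LinearMap.id)⁆ =
      ((m : ℂ) * k) • (TensorProduct.map 1 Y + TensorProduct.map Y 1) := by
  have h1 : ⁅X, k • (1 : Module.End ℂ M)⁆ = 0 := by rw [bracket_smul]; simp [Ring.lie_def]
  rw [← Module.End.one_eq_id, bracket_add, diagAction_bracket_map, diagAction_bracket_map, hX, h1]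
  simp only [TensorProduct.map_zero_left, TensorProduct.map_zero_right, TensorProduct.map_smul_left,
    TensorProduct.map_smul_right, zero_add, add_zero]
  module

theorem casimir_eq (D : FockModes M) (k : ℂ) (n : ℤ) :
    D.casimir k n = tensorField D.e D.f n + tensorField D.f D.e n
      + (1 / 2 : ℂ) • tensorField (D.h k) (D.h k) n
      - (TensorProduct.map (k • LinearMap.id) (D.virasoro k n)
        + TensorProduct.map (D.virasoro k n) (k • LinearMap.id)) := by
  rw [FockModes.casimir, sub_sub]

theorem diagAction_e_bracket_casimir (hD : IsFock D (k + 1)) (hk : k ≠ -2 ∨ D.α + D.γ = 0) (m : ℤ) :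
    ⁅diagAction (D.e m), D.casimir k 0⁆ = 0 := by
  have he := hD.isField_e
  have hf := hD.isField_f
  have hh := hD.isField_h k
  have hhm := (hh.shift m).add (IsField.mono ((m : ℂ) * k) (-m))
  have hem := (he.shift m).smul (-2)
  rw [casimir_eq, bracket_sub, bracket_add, bracket_add, bracket_smul,
    diagAction_bracket_translation (hD.bracket_e_virasoro hk m),
    diagAction_bracket_tensorField (D.e m) he hf .zero hhm (hD.bracket_e_e m) (hD.bracket_e_f m),
    diagAction_bracket_tensorField (D.e m) hf he hhm .zero (hD.bracket_e_f m) (hD.bracket_e_e m),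
    diagAction_bracket_tensorField (D.e m) hh hh hem hem (hD.bracket_e_h m) (hD.bracket_e_h m),
    tensorField_zero_left, tensorField_zero_right,
    tensorField_add_left (hh.shift m) (.mono _ _) he, tensorField_add_right he (hh.shift m) (.mono _ _),
    tensorField_mono_left, tensorField_mono_right, tensorField_smul_left _ (he.shift m) hh,
    tensorField_smul_right _ hh (he.shift m), tensorField_shift_right, tensorField_shift_right,
    tensorField_shift_left he hh, tensorField_shift_left hh he,
    show (0 : ℤ) - -m - 1 = m - 1 by ring]
  module

theorem diagAction_f_bracket_casimir (hD : IsFock D (k + 1)) (hk : k ≠ -2 ∨ D.α + D.γ = 0) (m : ℤ) :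
    ⁅diagAction (D.f m), D.casimir k 0⁆ = 0 := by
  have he := hD.isField_e
  have hf := hD.isField_f
  have hh := hD.isField_h k
  have hhm := (hh.shift m).neg.add (IsField.mono ((m : ℂ) * k) (-m))
  have hfm := (hf.shift m).smul 2
  have hneg : -shiftField (D.h k) m = (-1 : ℂ) • shiftField (D.h k) m := (neg_one_smul ℂ _).symm
  rw [casimir_eq, bracket_sub, bracket_add, bracket_add, bracket_smul,
    diagAction_bracket_translation (hD.bracket_f_virasoro hk m),
    diagAction_bracket_tensorField (D.f m) he hf hhm .zero (hD.bracket_f_e m) (hD.bracket_f_f m),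
    diagAction_bracket_tensorField (D.f m) hf he .zero hhm (hD.bracket_f_f m) (hD.bracket_f_e m),
    diagAction_bracket_tensorField (D.f m) hh hh hfm hfm (hD.bracket_f_h m) (hD.bracket_f_h m),
    tensorField_zero_left, tensorField_zero_right,
    tensorField_add_left (hh.shift m).neg (.mono _ _) hf,
    tensorField_add_right hf (hh.shift m).neg (.mono _ _), hneg,
    tensorField_mono_left, tensorField_mono_right, tensorField_smul_left _ (hf.shift m) hh,
    tensorField_smul_right _ hh (hf.shift m), tensorField_smul_left _ (hh.shift m) hf,
    tensorField_smul_right _ hf (hh.shift m), tensorField_shift_right, tensorField_shift_right,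
    tensorField_shift_left hf hh, tensorField_shift_left hh hf,
    show (0 : ℤ) - -m - 1 = m - 1 by ring]
  module

theorem diagAction_h_bracket_casimir (hD : IsFock D (k + 1)) (hk : k ≠ -2 ∨ D.α + D.γ = 0) (m : ℤ) :
    ⁅diagAction (D.h k m), D.casimir k 0⁆ = 0 := by
  have he := hD.isField_e
  have hf := hD.isField_f
  have hh := hD.isField_h k
  have hem := (he.shift m).smul 2
  have hfm := (hf.shift m).smul (-2)
  have hm := IsField.mono (M := M) ((m : ℂ) * (2 * k)) (-m)
  rw [casimir_eq, bracket_sub, bracket_add, bracket_add, bracket_smul,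
    diagAction_bracket_translation (hD.bracket_h_virasoro hk m),
    diagAction_bracket_tensorField (D.h k m) he hf hem hfm (hD.bracket_h_e m) (hD.bracket_h_f m),
    diagAction_bracket_tensorField (D.h k m) hf he hfm hem (hD.bracket_h_f m) (hD.bracket_h_e m),
    diagAction_bracket_tensorField (D.h k m) hh hh hm hm (hD.bracket_h_h m) (hD.bracket_h_h m),
    tensorField_mono_left, tensorField_mono_right, tensorField_smul_left _ (he.shift m) hf,
    tensorField_smul_right _ hf (he.shift m), tensorField_smul_left _ (hf.shift m) he,
    tensorField_smul_right _ he (hf.shift m), tensorField_shift_right, tensorField_shift_right,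
    tensorField_shift_left he hf, tensorField_shift_left hf he,
    show (0 : ℤ) - -m - 1 = m - 1 by ring]
  module

theorem diagCurrent_eq (D : FockModes M) (k : ℂ) (x : LieAlgebra.SpecialLinear.sl (Fin 2) ℂ) (m : ℤ) :
    D.diagCurrent k x m = x.1 0 1 • diagAction (D.e m) + x.1 1 0 • diagAction (D.f m)
      + x.1 0 0 • diagAction (D.h k m) := by
  simp only [FockModes.diagCurrent, FockModes.current, diagAction, TensorProduct.map_add_left,
    TensorProduct.map_add_right, TensorProduct.map_smul_left, TensorProduct.map_smul_right]
  module

/-- The residue of the Casimir field commutes with the diagonal action of the affine Lie algebra: the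
terms `e ⊗ f + f ⊗ e + ½ h ⊗ h` contribute only through the central term, and this is cancelled by the
translation operators. -/
theorem commute_diagCurrent_casimir (hD : IsFock D (k + 1)) (hk : k ≠ -2 ∨ D.α + D.γ = 0)
    (x : LieAlgebra.SpecialLinear.sl (Fin 2) ℂ) (m : ℤ) :
    Commute (D.diagCurrent k x m) (D.casimir k 0) := by
  have h : ∀ {X Y : Module.End ℂ (M ⊗[ℂ] M)}, ⁅X, Y⁆ = 0 → Commute X Y := fun h => sub_eq_zero.1 h
  rw [diagCurrent_eq]
  exact (((h (hD.diagAction_e_bracket_casimir hk m)).smul_left _).add_left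
    ((h (hD.diagAction_f_bracket_casimir hk m)).smul_left _)).add_left
    ((h (hD.diagAction_h_bracket_casimir hk m)).smul_left _)

theorem vacSubmodule_le_ker_casimir (hD : IsFock D (k + 1)) (hk : k ≠ -2 ∨ D.α + D.γ = 0) :
    D.vacSubmodule k ≤ LinearMap.ker (D.casimir k 0) := by
  refine sInf_le ⟨hD.casimir_vac, fun x m w hw => ?_⟩
  rw [LinearMap.mem_ker] at hw ⊢
  rw [← Module.End.mul_apply, ← (hD.commute_diagCurrent_casimir hk x m).eq, Module.End.mul_apply, hw,
    map_zero]

end IsFock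

end Casimir

/-! ### The two bosonic Fock spaces -/

section Concrete

variable {s : Type}

theorem dVar_apply (u : s) (n : ℕ+) (p : MvPolynomial (s × ℕ+) ℂ) (m : ℤ) :
    dVar u n (LaurentPolynomial.C p * LaurentPolynomial.T m) =
      LaurentPolynomial.C (MvPolynomial.pderiv (u, n) p) * LaurentPolynomial.T m := by
  simp only [← LaurentPolynomial.single_eq_C_mul_T]
  show AddMonoidAlgebra.ofCoeff (Finsupp.mapRange.linearMap
    (MvPolynomial.pderiv (R := ℂ) (u, n)).toLinearMap (Finsupp.single m p)) = _
  rw [Finsupp.mapRange.linearMap_apply, Finsupp.mapRange_single]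
  rfl

theorem qdq_apply (p : MvPolynomial (s × ℕ+) ℂ) (m : ℤ) :
    qdq (LaurentPolynomial.C p * LaurentPolynomial.T m) =
      (m : ℂ) • (LaurentPolynomial.C p * LaurentPolynomial.T m) := by
  simp only [← LaurentPolynomial.single_eq_C_mul_T]
  show AddMonoidAlgebra.ofCoeff (Finsupp.lsum ℂ (fun m : ℤ => (m : ℂ) • Finsupp.lsingle m)
    (Finsupp.single m p)) = _
  rw [Finsupp.lsum_single]
  rfl

theorem mulVar_apply (u : s) (n : ℕ+) (p : MvPolynomial (s × ℕ+) ℂ) (m : ℤ) :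
    mulVar u n (LaurentPolynomial.C p * LaurentPolynomial.T m) =
      LaurentPolynomial.C (MvPolynomial.X (u, n) * p) * LaurentPolynomial.T m := by
  rw [mulVar, LinearMap.mulLeft_apply, ← mul_assoc, map_mul]

theorem mulQ_apply (e : ℤ) (p : MvPolynomial (s × ℕ+) ℂ) (m : ℤ) :
    mulQ e (LaurentPolynomial.C p * LaurentPolynomial.T m) =
      LaurentPolynomial.C p * LaurentPolynomial.T (e + m) := by
  rw [mulQ, LinearMap.mulLeft_apply, mul_left_comm, LaurentPolynomial.T_add]

/-- Operators on the Fock space which agree on all `p qᵐ` are equal. -/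
theorem fock_end_ext {F G : Module.End ℂ (Fock s)}
    (h : ∀ p m, F (LaurentPolynomial.C p * LaurentPolynomial.T m) =
      G (LaurentPolynomial.C p * LaurentPolynomial.T m)) : F = G := by
  refine LinearMap.ext fun f => ?_
  induction f using LaurentPolynomial.induction_on' with
  | add f g hf hg => rw [map_add, map_add, hf, hg]
  | C_mul_T n a => exact h _ _

theorem commute_dVar_dVar (u w : s) (n m : ℕ+) : Commute (dVar u n) (dVar w m) := by
  have h : ⁅MvPolynomial.pderiv (R := ℂ) (u, n), MvPolynomial.pderiv (R := ℂ) (w, m)⁆ = 0 := by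
    classical
    refine MvPolynomial.derivation_ext fun i => ?_
    rw [Derivation.commutator_apply, MvPolynomial.pderiv_X, MvPolynomial.pderiv_X, Pi.single_apply,
      Pi.single_apply]
    split_ifs <;> simp
  refine fock_end_ext fun p j => ?_
  have hp := DFunLike.congr_fun h p
  rw [Derivation.commutator_apply, Derivation.zero_apply, sub_eq_zero] at hp
  simp only [Module.End.mul_apply, dVar_apply, hp]

theorem commute_mulVar_mulVar (u w : s) (n m : ℕ+) : Commute (mulVar u n) (mulVar w m) :=
  fock_end_ext fun p j => by simp only [Module.End.mul_apply, mulVar_apply, mul_left_comm]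

open Classical in
theorem bracket_dVar_mulVar (u w : s) (n m : ℕ+) :
    ⁅dVar u n, mulVar w m⁆ = if n = m then (if w = u then (1 : ℂ) else 0) • 1 else 0 := by
  have key : MvPolynomial.pderiv (R := ℂ) (u, n) (MvPolynomial.X (w, m)) =
      if n = m then (if w = u then 1 else 0) else 0 := by
    rw [MvPolynomial.pderiv_X, Pi.single_apply]
    by_cases h1 : w = u <;> by_cases h2 : n = m
    · simp [h1, h2]
    · simp [h1, h2, Ne.symm h2]
    · simp [h1, h2]
    · simp [h1, h2]
  refine fock_end_ext fun p j => ?_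
  rw [Ring.lie_def, LinearMap.sub_apply, Module.End.mul_apply, Module.End.mul_apply, mulVar_apply,
    dVar_apply, dVar_apply, mulVar_apply, ← sub_mul, ← map_sub, Derivation.leibniz, key, smul_eq_mul,
    smul_eq_mul, add_sub_cancel_left]
  split_ifs <;> simp

theorem commute_qdq_dVar (u : s) (n : ℕ+) : Commute qdq (dVar u n) :=
  fock_end_ext fun p j => by simp only [Module.End.mul_apply, dVar_apply, qdq_apply, map_smul]

theorem commute_qdq_mulVar (u : s) (n : ℕ+) : Commute qdq (mulVar u n) :=
  fock_end_ext fun p j => by simp only [Module.End.mul_apply, mulVar_apply, qdq_apply, map_smul]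

theorem commute_mulQ_dVar (e : ℤ) (u : s) (n : ℕ+) : Commute (mulQ e) (dVar u n) :=
  fock_end_ext fun p j => by simp only [Module.End.mul_apply, dVar_apply, mulQ_apply]

theorem commute_mulQ_mulVar (e : ℤ) (u : s) (n : ℕ+) : Commute (mulQ e) (mulVar u n) :=
  fock_end_ext fun p j => by simp only [Module.End.mul_apply, mulVar_apply, mulQ_apply]

theorem bracket_qdq_mulQ (e : ℤ) : ⁅(qdq : Module.End ℂ (Fock s)), (mulQ e : Module.End ℂ (Fock s))⁆ = (e : ℂ) • mulQ e :=
  fock_end_ext fun p j => by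
    simp only [Ring.lie_def, LinearMap.sub_apply, LinearMap.smul_apply, Module.End.mul_apply, mulQ_apply,
      qdq_apply, map_smul]
    push_cast
    module

theorem mulQ_zero : (mulQ 0 : Module.End ℂ (Fock s)) = 1 :=
  fock_end_ext fun p j => by simp only [mulQ_apply, Module.End.one_apply, zero_add]

theorem mulQ_add (e e' : ℤ) : (mulQ (e + e') : Module.End ℂ (Fock s)) = mulQ e * mulQ e' :=
  fock_end_ext fun p j => by simp only [mulQ_apply, Module.End.mul_apply, add_assoc]

theorem one_eq_C_mul_T : (1 : Fock s) = LaurentPolynomial.C 1 * LaurentPolynomial.T 0 := by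
  rw [LaurentPolynomial.T_zero, map_one, mul_one]

theorem dVar_one (u : s) (n : ℕ+) : dVar u n 1 = 0 := by
  rw [one_eq_C_mul_T, dVar_apply, ← MvPolynomial.C_1, MvPolynomial.pderiv_C, map_zero, zero_mul]

theorem qdq_one : (qdq : Module.End ℂ (Fock s)) 1 = 0 := by
  rw [one_eq_C_mul_T, qdq_apply, Int.cast_zero, zero_smul]

/-- The constant function `1` generates the Fock space under multiplication by the variables and by
powers of `q`. -/
theorem fock_cyclic (W : Submodule ℂ (Fock s)) (h1 : 1 ∈ W) (hX : ∀ u n, ∀ w ∈ W, mulVar u n w ∈ W)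
    (hq : ∀ e, ∀ w ∈ W, mulQ e w ∈ W) (v : Fock s) : v ∈ W := by
  have hC : ∀ p : MvPolynomial (s × ℕ+) ℂ, LaurentPolynomial.C p ∈ W := by
    intro p
    induction p using MvPolynomial.induction_on with
    | C a =>
      have h2 := W.smul_mem a h1
      rw [Algebra.smul_def, mul_one] at h2
      exact h2
    | add p r hp hr =>
      rw [map_add]
      exact W.add_mem hp hr
    | mul_X p i hp =>
      have := hX i.1 i.2 _ hp
      rwa [mulVar, LinearMap.mulLeft_apply, ← map_mul, mul_comm] at this
  induction v using LaurentPolynomial.induction_on' with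
  | add f g hf hg => exact W.add_mem hf hg
  | C_mul_T n a =>
    have := hq n _ (hC a)
    rwa [mulQ, LinearMap.mulLeft_apply, mul_comm] at this

/-- `ann n` is a linear combination of the derivatives `∂/∂uₙ`, with the coefficients `coef u`
independent of `n`. This is encoded by the properties of such a combination which are used: its
brackets with the variables, membership in the bicommutant of the derivatives, and the value on `1`. -/
structure AnnihilationOps (ann : ℕ+ → Module.End ℂ (Fock s)) (coef : s → ℂ) : Prop where
  bracket_mulVar : ∀ n w m, ⁅ann n, mulVar w m⁆ = if n = m then coef w • 1 else 0
  commute : ∀ X : Module.End ℂ (Fock s), (∀ u m, Commute X (dVar u m)) → ∀ n, Commute X (ann n)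
  one : ∀ n, ann n 1 = 0

open Classical in
theorem annihilationOps_dVar (u : s) :
    AnnihilationOps (fun n => dVar u n) fun w => if w = u then 1 else 0 where
  bracket_mulVar n w m := bracket_dVar_mulVar u w n m
  commute _ hX n := hX u n
  one n := dVar_one u n

variable {ann ann' : ℕ+ → Module.End ℂ (Fock s)} {coef coef' : s → ℂ}

namespace AnnihilationOps

theorem smul (r : ℂ) (h : AnnihilationOps ann coef) :
    AnnihilationOps (fun n => r • ann n) fun w => r * coef w where
  bracket_mulVar n w m := by
    rw [smul_bracket, h.bracket_mulVar]
    split_ifs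
    · rw [smul_smul]
    · rw [smul_zero]
  commute X hX n := (h.commute X hX n).smul_right r
  one n := by rw [LinearMap.smul_apply, h.one, smul_zero]

theorem add (h : AnnihilationOps ann coef) (h' : AnnihilationOps ann' coef') :
    AnnihilationOps (fun n => ann n + ann' n) fun w => coef w + coef' w where
  bracket_mulVar n w m := by
    rw [add_bracket, h.bracket_mulVar, h'.bracket_mulVar]
    split_ifs
    · rw [add_smul]
    · rw [add_zero]
  commute X hX n := (h.commute X hX n).add_right (h'.commute X hX n)
  one n := by rw [LinearMap.add_apply, h.one, h'.one, add_zero]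

theorem sub (h : AnnihilationOps ann coef) (h' : AnnihilationOps ann' coef') :
    AnnihilationOps (fun n => ann n - ann' n) fun w => coef w - coef' w := by
  have e : (fun n => ann n - ann' n) = fun n => ann n + (-1 : ℂ) • ann' n :=
    funext fun n => sub_eq_add_neg_one_smul _ _
  have e' : (fun w => coef w - coef' w) = fun w => coef w + -1 * coef' w := funext fun w => by ring
  rw [e, e']
  exact h.add (h'.smul (-1))

end AnnihilationOps

theorem int_eq_zero_or_pnat (m : ℤ) : m = 0 ∨ (∃ n : ℕ+, m = n) ∨ ∃ n : ℕ+, m = -n := by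
  rcases lt_trichotomy m 0 with h | h | h
  · exact .inr (.inr ⟨⟨m.natAbs, by omega⟩, by rw [PNat.mk_coe]; omega⟩)
  · exact .inl h
  · exact .inr (.inl ⟨⟨m.natAbs, by omega⟩, by rw [PNat.mk_coe]; omega⟩)

variable {zero zero' : Module.End ℂ (Fock s)} {u u' : s} {μ μ' κ : ℂ}

theorem heisenberg_zero : heisenberg ann zero u 0 = zero := rfl

theorem heisenberg_pos (n : ℕ+) : heisenberg ann zero u n = ann n := by
  obtain ⟨n, rfl⟩ : ∃ k : ℕ, n = k.succPNat := ⟨n.natPred, (PNat.succPNat_natPred n).symm⟩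
  rfl

theorem heisenberg_neg (n : ℕ+) : heisenberg ann zero u (-n) = (n : ℂ) • mulVar u n := by
  obtain ⟨n, rfl⟩ : ∃ k : ℕ, n = k.succPNat := ⟨n.natPred, (PNat.succPNat_natPred n).symm⟩
  rfl

theorem heisenbergPair_heisenberg (h : AnnihilationOps ann coef) (h' : AnnihilationOps ann' coef')
    (hz : zero = μ • qdq) (hz' : zero' = μ' • qdq) (hκ : coef u' = κ) (hκ' : coef' u = κ) :
    HeisenbergPair (heisenberg ann zero u) (heisenberg ann' zero' u') κ := by
  have hq := h.commute qdq commute_qdq_dVar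
  have hq' := h'.commute qdq commute_qdq_dVar
  have haa : ∀ n m, Commute (ann n) (ann' m) := fun n m =>
    h'.commute _ (fun w i => (h.commute _ (fun w' i' => commute_dVar_dVar w w' i i') n).symm) m
  subst hz hz'
  intro m n
  rcases int_eq_zero_or_pnat m with rfl | ⟨m, rfl⟩ | ⟨m, rfl⟩ <;>
    rcases int_eq_zero_or_pnat n with rfl | ⟨n, rfl⟩ | ⟨n, rfl⟩ <;>
    simp only [heisenberg_zero, heisenberg_pos, heisenberg_neg]
  · rw [((Commute.refl _).smul_left _ |>.smul_right _).lie_eq]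
    simp
  · rw [((hq' n).smul_left _).lie_eq]
    simp
  · rw [(((commute_qdq_mulVar u' n).smul_left _).smul_right _).lie_eq]
    simp
  · rw [((hq m).symm.smul_right _).lie_eq, if_neg (by have := m.pos; omega)]
  · rw [(haa m n).lie_eq, if_neg (by have := m.pos; omega)]
  · rw [bracket_smul, h.bracket_mulVar, hκ]
    by_cases hmn : m = n
    · subst hmn
      rw [if_pos rfl, if_pos (by omega), smul_smul, Int.cast_natCast]
    · rw [if_neg hmn, if_neg (fun h0 => hmn (PNat.eq (by omega))), smul_zero]
  · rw [(((commute_qdq_mulVar u m).symm.smul_left _).smul_right _).lie_eq,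
      if_neg (by have := m.pos; omega)]
  · rw [bracket_swap, bracket_smul, h'.bracket_mulVar, hκ']
    by_cases hmn : n = m
    · subst hmn
      rw [if_pos rfl, if_pos (by omega), smul_smul, smul_smul, Int.cast_neg, Int.cast_natCast, neg_one_mul]
    · rw [if_neg hmn, if_neg (fun h0 => hmn (PNat.eq (by omega))), smul_zero, smul_zero]
  · rw [(((commute_mulVar_mulVar u u' m n).smul_left _).smul_right _).lie_eq,
      if_neg (by have := m.pos; omega)]

theorem bracket_heisenberg_mulQ (h : AnnihilationOps ann coef) (hz : zero = μ • qdq) (m e : ℤ) :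
    ⁅heisenberg ann zero u m, (mulQ e : Module.End ℂ (Fock s))⁆ = if m = 0 then ((e : ℂ) * μ) • mulQ e else 0 := by
  rcases int_eq_zero_or_pnat m with rfl | ⟨m, rfl⟩ | ⟨m, rfl⟩
  · rw [heisenberg_zero, if_pos rfl, hz, smul_bracket, bracket_qdq_mulQ, smul_smul, mul_comm]
  · rw [heisenberg_pos, if_neg (by have := m.pos; omega),
      (h.commute (mulQ e) (commute_mulQ_dVar e) m).symm.lie_eq]
  · rw [heisenberg_neg, if_neg (by have := m.pos; omega),
      ((commute_mulQ_mulVar e u m).symm.smul_left _).lie_eq]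

theorem heisenberg_one (h : AnnihilationOps ann coef) (hz : zero = μ • qdq) (n : ℤ) (hn : n ≥ 0) :
    heisenberg ann zero u n 1 = 0 := by
  rcases int_eq_zero_or_pnat n with rfl | ⟨n, rfl⟩ | ⟨n, rfl⟩
  · rw [heisenberg_zero, hz, LinearMap.smul_apply, qdq_one, smul_zero]
  · rw [heisenberg_pos, h.one]
  · have := n.pos
    omega

theorem mulVar_mem_of_heisenberg {W : Submodule ℂ (Fock s)}
    (hW : ∀ n < 0, ∀ w ∈ W, heisenberg ann zero u n w ∈ W) (n : ℕ+) (w : Fock s) (hw : w ∈ W) :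
    mulVar u n w ∈ W := by
  have h := hW (-n) (by have := n.pos; omega) w hw
  rw [heisenberg_neg, LinearMap.smul_apply] at h
  exact (W.smul_mem_iff (Nat.cast_ne_zero.2 n.ne_zero)).1 h

/-- The operators on `ℂ[x, y, t; q, q⁻¹]` satisfy the Heisenberg relations, and the space is generated
by `1`. -/
theorem isFock_fockModes (c : ℂ) : IsFock (fockModes c) c := by
  have hx := annihilationOps_dVar XYT.x
  have hy := annihilationOps_dVar XYT.y
  have ht := annihilationOps_dVar XYT.t
  have hα := (hx.add (hy.smul c)).add ht
  have hγ := ((hx.smul c).add hy).sub ht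
  have hδ := hx.sub hy
  have zα : (qdq : Module.End ℂ (Fock XYT)) = (1 : ℂ) • qdq := (one_smul ℂ _).symm
  have zγ : (-qdq : Module.End ℂ (Fock XYT)) = (-1 : ℂ) • qdq := neg_eq_neg_one_smul _
  have zδ : (0 : Module.End ℂ (Fock XYT)) = (0 : ℂ) • qdq := (zero_smul ℂ _).symm
  exact
    { αα := heisenbergPair_heisenberg hα hα zα zα (by simp) (by simp)
      γγ := heisenbergPair_heisenberg hγ hγ zγ zγ (by simp) (by simp)
      αγ := heisenbergPair_heisenberg hα hγ zα zγ (by simp) (by simp)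
      αδ := heisenbergPair_heisenberg hα hδ zα zδ (by simp) (by simp)
      γδ := heisenbergPair_heisenberg hγ hδ zγ zδ (by simp) (by simp)
      δδ := heisenbergPair_heisenberg hδ hδ zδ zδ (by simp) (by simp)
      charged_α := bracket_heisenberg_mulQ hα zα
      charged_γ := bracket_heisenberg_mulQ hγ zγ
      charged_δ := bracket_heisenberg_mulQ hδ zδ
      δ_zero := rfl
      q_zero := mulQ_zero
      q_add := mulQ_add
      α_vac := heisenberg_one hα zα
      γ_vac := heisenberg_one hγ zγ
      δ_vac := heisenberg_one hδ zδ
      cyclic := fun W h1 hWα hWγ hWδ hWq => by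
        refine fock_cyclic W h1 (fun u n w hw => ?_) hWq
        cases u with
        | x => exact mulVar_mem_of_heisenberg hWα n w hw
        | y => exact mulVar_mem_of_heisenberg hWγ n w hw
        | t => exact mulVar_mem_of_heisenberg hWδ n w hw }

theorem critFockModes_γ : critFockModes.γ = (-1 : ℂ) • critFockModes.α :=
  funext fun _ => neg_eq_neg_one_smul _

theorem critFockModes_α_add_γ : critFockModes.α + critFockModes.γ = 0 := by
  rw [critFockModes_γ]
  exact funext fun _ => add_neg_one_smul _

/-- The operators on `ℂ[x, t; q, q⁻¹]` with `γ = -α` satisfy the Heisenberg relations for `c = -1`, and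
the space is generated by `1`. -/
theorem isFock_critFockModes : IsFock critFockModes (-1) := by
  have hx := annihilationOps_dVar XT.x
  have ht := annihilationOps_dVar XT.t
  have hα := hx.add ht
  have zα : (qdq : Module.End ℂ (Fock XT)) = (1 : ℂ) • qdq := (one_smul ℂ _).symm
  have zδ : (0 : Module.End ℂ (Fock XT)) = (0 : ℂ) • qdq := (zero_smul ℂ _).symm
  have hγ : critFockModes.γ = (-1 : ℂ) • critFockModes.α := critFockModes_γ
  have αα : HeisenbergPair critFockModes.α critFockModes.α 1 :=
    heisenbergPair_heisenberg hα hα zα zα (by simp) (by simp)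
  have αδ : HeisenbergPair critFockModes.α critFockModes.δ 1 :=
    heisenbergPair_heisenberg hα hx zα zδ (by simp) (by simp)
  have γα : HeisenbergPair critFockModes.γ critFockModes.α (-1) := by
    simpa [hγ] using αα.smul_left (-1)
  have charged_α : Charged critFockModes critFockModes.α 1 := bracket_heisenberg_mulQ hα zα
  have α_vac : ∀ n ≥ 0, critFockModes.α n critFockModes.vac = 0 := heisenberg_one hα zα
  exact
    { αα := αα
      γγ := by simpa [hγ] using γα.symm.smul_left (-1)
      αγ := γα.symm
      αδ := αδ
      γδ := by simpa [hγ] using αδ.smul_left (-1)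
      δδ := heisenbergPair_heisenberg hx hx zδ zδ (by simp) (by simp)
      charged_α := charged_α
      charged_γ := fun m e => by
        rw [hγ, Pi.smul_apply, smul_bracket, charged_α]
        split_ifs
        · module
        · rw [smul_zero]
      charged_δ := bracket_heisenberg_mulQ hx zδ
      δ_zero := rfl
      q_zero := mulQ_zero
      q_add := mulQ_add
      α_vac := α_vac
      γ_vac := fun n hn => by rw [hγ, Pi.smul_apply, LinearMap.smul_apply, α_vac n hn, smul_zero]
      δ_vac := heisenberg_one hx zδ
      cyclic := fun W h1 hWα _ hWδ hWq => by
        refine fock_cyclic W h1 (fun u n w hw => ?_) hWq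
        cases u with
        | x => exact mulVar_mem_of_heisenberg hWα n w hw
        | t => exact mulVar_mem_of_heisenberg hWδ n w hw }

end Concrete

end

end Wakimoto

theorem corollary3p2 (k : ℂ) :
    (k ≠ -2 → ∀ τ : Wakimoto.Fock Wakimoto.XYT,
      τ ⊗ₜ[ℂ] τ ∈ (Wakimoto.fockModes (k + 1)).vacSubmodule k →
        (Wakimoto.fockModes (k + 1)).casimir k 0 (τ ⊗ₜ[ℂ] τ) = 0) ∧
    (k = -2 → ∀ τ : Wakimoto.Fock Wakimoto.XT,
      τ ⊗ₜ[ℂ] τ ∈ Wakimoto.critFockModes.vacSubmodule k →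
        Wakimoto.critFockModes.casimir k 0 (τ ⊗ₜ[ℂ] τ) = 0) := by
  refine ⟨fun hk τ hτ => ?_, fun hk τ hτ => ?_⟩
  · exact (Wakimoto.isFock_fockModes (k + 1)).vacSubmodule_le_ker_casimir (.inl hk) hτ
  · have hD : Wakimoto.IsFock Wakimoto.critFockModes (k + 1) := by
      rw [hk, show (-2 + 1 : ℂ) = -1 by norm_num]
      exact Wakimoto.isFock_critFockModes
    exact hD.vacSubmodule_le_ker_casimir (.inr Wakimoto.critFockModes_α_add_γ) hτ
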